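/- For a set $A\subseteq\{0,1\}^*$, let $\mathrm{UP}^A$ be the class of languages $L\subseteq\{0,1\}^*$ that are accepted, relative to the oracle $A$, by a nondeterministic polynomial-time oracle Turing machine that, with oracle $A$, has on no input more than one accepting computation path. For a class $\mathcal K$ of languages, put $\mathrm{co}\mathcal K=\{L : \overline{L}\in\mathcal K\}$ and define - $\mathrm C_1(\mathcal K)=\mathcal K$ and, for $k\ge 2$, $\mathrm C_k(\mathcal K)=\{A\cup B : A\in \mathrm C_{k-1}(\mathcal K),\,B\in\mathcal K\}$ if $k$ is odd, $\mathrm C_k(\mathcal K)=\{A\cap B : A\in \mathrm C_{k-1}(\mathcal K),\,B\in\mathrm{co}\mathcal K\}$ if $k$ is even; - (nested difference hierarchy) $\mathrm D_1(\mathcal K)=\mathcal K$, $\mathrm D_k(\mathcal K)=\{A- B : A\in \mathcal K,\,B\in \mathrm D_{k-1}(\mathcal K)\}$ for $k\ge 2$, and $\mathrm{DH}(\mathcal K)=\bigcup_{k\ge1}\mathrm D_k(\mathcal K)$; - (Hausdorff hierarchy) $\mathrm E_1(\mathcal K)=\mathcal K$, $\mathrm E_2(\mathcal K)=\{A- B :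 A,B\in\mathcal K\}$, $\mathrm E_k(\mathcal K)=\{A\cup B : A\in \mathrm E_2(\mathcal K),\,B\in \mathrm E_{k-2}(\mathcal K)\}$ for $k>2$, and $\mathrm{EH}(\mathcal K)=\bigcup_{k\ge1}\mathrm E_k(\mathcal K)$; - $\mathrm{SD}_1(\mathcal K)=\mathcal K$, $\mathrm{SD}_k(\mathcal K)=\{A\,\Delta\, B : A\in \mathrm{SD}_{k-1}(\mathcal K),\,B\in\mathcal K\}$ for $k\ge2$; - $\mathrm{BC}(\mathcal K)$, the Boolean algebra of languages generated by $\mathcal K$. **Theorem.** There are recursive oracles $A$ and $D$, and one may take $A=D$, such that $$\mathrm C_4(\mathrm{UP}^A)\not\subseteq \mathrm{EH}(\mathrm{UP}^A)\quad\text{and}\quad \mathrm{SD}_3(\mathrm{UP}^D)\not\subseteq \mathrm{EH}(\mathrm{UP}^D).$$ Moreover, for such a recursive oracle $A=D$, neither the Hausdorff hierarchy nor the nested difference hierarchy over $\mathrm{UP}^A$ captures the Boolean closure of $\mathrm{UP}^A$: $$\mathrm{EH}(\mathrm{UP}^A)\neq\mathrm{BC}(\mathrm{UP}^A)\quad\text{and}\quad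 \mathrm{DH}(\mathrm{UP}^A)\neq\mathrm{BC}(\mathrm{UP}^A).$$ -/

import Mathlib

namespace UPOracle

/-- Strings over the alphabet `{0,1}`. -/
abbrev Word := List Bool

/-- Subsets of `{0,1}*`: languages, and also oracles. -/
abbrev Lang := Set Word

/-! ### Nondeterministic oracle Turing machines

States and tape symbols are named by natural numbers. A machine has a finite program, so only
finitely many states and symbols are ever in use. The symbol `0` is the blank. -/

/-- The tape symbol that stands for an input bit. -/
def bitSymbol (b : Bool) : ℕ := if b then 2 else 1

/-- Head movements: one cell to the left, no movement, one cell to the right. -/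
inductive Move
  | left
  | stay
  | right
  deriving DecidableEq

/-- A tape that is infinite in both directions and blank outside a finite part. The scanned cell
is the first cell of `right`; `left` lists the cells to the left of it, nearest first. -/
structure Tape where
  left : List ℕ
  right : List ℕ
  deriving DecidableEq

/-- The scanned symbol. -/
def Tape.read (t : Tape) : ℕ := t.right.headD 0

/-- Write `a` in the scanned cell, then move the head. -/
def Tape.act (t : Tape) (a : ℕ) : Move → Tape
  | .left => ⟨t.left.tail, t.left.headD 0 :: a :: t.right.tail⟩
  | .stay => ⟨t.left, a :: t.right.tail⟩
  | .right => ⟨a :: t.left, t.right.tail⟩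

/-- A transition of a machine with a read-only input tape, a work tape, and a one-way write-only
oracle tape: in state `state`, scanning `readInput` and `readWork`, the machine may go to the state
`next`, move the input head, write on the work tape, move the work head, and append at most one
bit to the oracle tape. -/
structure Transition where
  state : ℕ
  readInput : ℕ
  readWork : ℕ
  next : ℕ
  moveInput : Move
  writeWork : ℕ
  moveWork : Move
  ask : Option Bool
  deriving DecidableEq

/-- A nondeterministic oracle Turing machine. The order and the multiplicity of the entries of the
program are irrelevant. In the state `query` the machine asks the oracle and continues in the
state `yes` or `no`. -/
structure Machine where
  start : ℕ
  accept : ℕ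
  query : ℕ
  yes : ℕ
  no : ℕ
  program : List Transition

/-- Configurations; `asked` is the content of the oracle tape. -/
structure Config where
  state : ℕ
  input : Tape
  work : Tape
  asked : Word
  deriving DecidableEq

/-- The configuration that the transition `i` leads to. -/
def Transition.apply (i : Transition) (c : Config) : Config where
  state := i.next
  input := c.input.act c.input.read i.moveInput
  work := c.work.act i.writeWork i.moveWork
  asked := c.asked ++ i.ask.toList

namespace Machine

/-- The initial configuration on input `x`: the input head scans the first bit of `x`, the
other tapes are blank. -/
def init (M : Machine) (x : Word) : Config where
  state := M.start
  input := ⟨[], x.map bitSymbol⟩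
  work := ⟨[], []⟩
  asked := []

/-- The one-step relation of `M` with oracle `A`. The accepting state is halting. A query takes
one step, is answered according to `A`, and erases the oracle tape. -/
inductive Step (M : Machine) (A : Lang) : Config → Config → Prop
  | move (c : Config) (i : Transition) (hacc : c.state ≠ M.accept) (hq : c.state ≠ M.query)
      (hi : i ∈ M.program) (hs : i.state = c.state) (hin : i.readInput = c.input.read)
      (hw : i.readWork = c.work.read) : Step M A c (i.apply c)
  | queryYes (c : Config) (hacc : c.state ≠ M.accept) (hq : c.state = M.query)
      (h : c.asked ∈ A) : Step M A c { c with state := M.yes, asked := [] }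
  | queryNo (c : Config) (hacc : c.state ≠ M.accept) (hq : c.state = M.query)
      (h : c.asked ∉ A) : Step M A c { c with state := M.no, asked := [] }

/-- `π` is a (possibly incomplete) computation path of `M` with oracle `A` on input `x`. -/
def IsPath (M : Machine) (A : Lang) (x : Word) (π : List Config) : Prop :=
  π.head? = some (M.init x) ∧ π.IsChain (M.Step A)

/-- `π` is an accepting computation path of `M` with oracle `A` on input `x`. -/
def IsAcceptingPath (M : Machine) (A : Lang) (x : Word) (π : List Config) : Prop :=
  M.IsPath A x π ∧ ∃ c, π.getLast? = some c ∧ c.state = M.accept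

/-- The language accepted by `M` with oracle `A`. -/
def language (M : Machine) (A : Lang) : Lang := {x | ∃ π, M.IsAcceptingPath A x π}

/-- `M` runs in polynomial time: some polynomial in the length of the input bounds the length of
every computation path, whatever the oracle is. -/
def IsPolyTime (M : Machine) : Prop :=
  ∃ p : Polynomial ℕ, ∀ (A : Lang) (x : Word) (π : List Config),
    M.IsPath A x π → π.length ≤ p.eval x.length

/-- `M` with oracle `A` has on no input more than one accepting computation path. -/
def IsUnambiguous (M : Machine) (A : Lang) : Prop :=
  ∀ (x : Word) (π₁ π₂ : List Config),
    M.IsAcceptingPath A x π₁ → M.IsAcceptingPath A x π₂ → π₁ = π₂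

end Machine

/-- The class `UP^A`. -/
def UP (A : Lang) : Set Lang :=
  {L | ∃ M : Machine, M.IsPolyTime ∧ M.IsUnambiguous A ∧ M.language A = L}

/-! ### Boolean hierarchies over a class of languages

The operations on classes are taken member by member; the levels are numbered from 1 on, and level
0 is a dummy value. -/

/-- The class of complements of members of `K`. -/
def co (K : Set Lang) : Set Lang := {L | Lᶜ ∈ K}

/-- All `A ∩ B` with `A ∈ K₁` and `B ∈ K₂`. -/
def classInter (K₁ K₂ : Set Lang) : Set Lang := {L | ∃ A ∈ K₁, ∃ B ∈ K₂, L = A ∩ B}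

/-- All `A ∪ B` with `A ∈ K₁` and `B ∈ K₂`. -/
def classUnion (K₁ K₂ : Set Lang) : Set Lang := {L | ∃ A ∈ K₁, ∃ B ∈ K₂, L = A ∪ B}

/-- All `A \ B` with `A ∈ K₁` and `B ∈ K₂`. -/
def classDiff (K₁ K₂ : Set Lang) : Set Lang := {L | ∃ A ∈ K₁, ∃ B ∈ K₂, L = A \ B}

/-- All symmetric differences of some `A ∈ K₁` and some `B ∈ K₂`. -/
def classSymmDiff (K₁ K₂ : Set Lang) : Set Lang := {L | ∃ A ∈ K₁, ∃ B ∈ K₂, L = symmDiff A B}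

/-- The levels `C_k(K)` of the Boolean ("alternating sums") hierarchy over `K`. -/
def C (K : Set Lang) : ℕ → Set Lang
  | 0 => ∅
  | 1 => K
  | k + 2 => if Odd (k + 2) then classUnion (C K (k + 1)) K else classInter (C K (k + 1)) (co K)

/-- The levels `D_k(K)` of the nested difference hierarchy over `K`. -/
def D (K : Set Lang) : ℕ → Set Lang
  | 0 => ∅
  | 1 => K
  | k + 2 => classDiff K (D K (k + 1))

/-- The levels `E_k(K)` of the Hausdorff ("union of differences") hierarchy over `K`. -/
def E (K : Set Lang) : ℕ → Set Lang
  | 0 => ∅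
  | 1 => K
  | 2 => classDiff K K
  | k + 3 => classUnion (classDiff K K) (E K (k + 1))

/-- The levels `SD_k(K)` of the symmetric difference hierarchy over `K`. -/
def SD (K : Set Lang) : ℕ → Set Lang
  | 0 => ∅
  | 1 => K
  | k + 2 => classSymmDiff (SD K (k + 1)) K

/-- The nested difference hierarchy over `K`. -/
def DH (K : Set Lang) : Set Lang := {L | ∃ k, 1 ≤ k ∧ L ∈ D K k}

/-- The Hausdorff hierarchy over `K`. -/
def EH (K : Set Lang) : Set Lang := {L | ∃ k, 1 ≤ k ∧ L ∈ E K k}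

/-- The Boolean closure of `K`, the Boolean algebra of languages generated by `K`. -/
def BC (K : Set Lang) : Set Lang := (BooleanSubalgebra.closure K : Set Lang)

end UPOracle

/-! The oracle is built so that for each tag `b` and each length at most one word `y ++ [b]` belongs
to it. Guessing `y` is then unambiguous, and the two languages `tagLang _ b` lie in UP. Both
separating languages, "in neither tag language" (a member of C₄) and "in an even number of them" (a
member of SD₃), contain the words in no tag language and omit those in exactly one.

Every level of EH and of DH consists of finite unions of sets (⋂ Mᵢ) \ N with UP machines Mᵢ and N
(`exists_combination_E`, `exists_combination_D`). Suppose such a union R were right at 0ⁿ when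
nothing, a single word u = y ++ [false], or a single word v = z ++ [true] is added, and its machines
stayed unambiguous when both are added, for all y, z of length n. With nothing added, some term (⋂
Mᵢ) \ N holds. For n large, counting yields u and v that the accepting paths of the Mᵢ do not query,
so the Mᵢ still accept after adding either word. As R must now fail, N accepts with u alone and with
v alone. Counting also ensures that neither of the chosen accepting paths of N queries the other
word, so both paths survive with u and v present. Unambiguity makes them equal; the common path
queries neither word, so N accepts with nothing added, a contradiction (`exists_robust_pair`,
`exists_spoils`).

Hence some choice of added words makes R ambiguous or wrong. When both words are added no value is
prescribed for R: that case serves only to break unambiguity. The construction searches for such a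
choice at tower-spaced lengths, too sparse for later words to disturb the computations, and
simulates with the clock 2ⁿ. Everything is primitive recursive, so the oracle is recursive
(`exists_stage_spoiled`, `computablePred_theOracle`). -/

namespace UPOracle

/-! ### Computation paths and the words they query -/

namespace Machine

theorem Step.congr {M : Machine} {A B : Lang} {c d : Config} (h : M.Step A c d)
    (hc : c.asked ∈ A ↔ c.asked ∈ B) : M.Step B c d := by
  cases h with
  | move i hacc hq hi hs hin hw => exact .move c i hacc hq hi hs hin hw
  | queryYes hacc hq h => exact .queryYes c hacc hq (hc.1 h)
  | queryNo hacc hq h => exact .queryNo c hacc hq (fun h' => h (hc.2 h'))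

/-- An accepting path depends only on the oracle's answers to the words on its oracle tape. -/
theorem IsAcceptingPath.congr {M : Machine} {A B : Lang} {x : Word} {π : List Config}
    (h : M.IsAcceptingPath A x π) (hπ : ∀ c ∈ π, c.asked ∈ A ↔ c.asked ∈ B) :
    M.IsAcceptingPath B x π := by
  refine ⟨⟨h.1.1, ?_⟩, h.2⟩
  exact h.1.2.imp_of_mem_imp fun c d hc _ hcd => hcd.congr (hπ c hc)

theorem Step.asked_length_le {M : Machine} {A : Lang} {c d : Config} (h : M.Step A c d) :
    d.asked.length ≤ c.asked.length + 1 := by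
  cases h with
  | move i =>
    cases hi : i.ask <;> simp [Transition.apply, hi]
  | queryYes => simp
  | queryNo => simp

theorem asked_length_le_of_isChain {M : Machine} {A : Lang} {π : List Config} :
    ∀ {c : Config}, (c :: π).IsChain (M.Step A) → ∀ d ∈ c :: π,
      d.asked.length ≤ c.asked.length + π.length := by
  induction π with
  | nil => simp
  | cons e π ih =>
    intro c h d hd
    rw [List.isChain_cons_cons] at h
    rcases List.mem_cons.1 hd with rfl | hd
    · simp
    · have h1 := ih h.2 d hd
      have h2 := h.1.asked_length_le
      simp only [List.length_cons]
      omega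

/-- The oracle tape starts empty and grows by at most one bit per step. Hence words at least as long
as the path are irrelevant to it. -/
theorem IsPath.asked_length_lt {M : Machine} {A : Lang} {x : Word} {π : List Config}
    (h : M.IsPath A x π) {c : Config} (hc : c ∈ π) : c.asked.length < π.length := by
  obtain ⟨h1, h2⟩ := h
  cases π with
  | nil => simp at hc
  | cons d π =>
    simp only [List.head?_cons, Option.some.injEq] at h1
    have := asked_length_le_of_isChain h2 c hc
    subst h1
    simpa [init, Nat.lt_succ_iff] using this

/-- `M.AcceptsVia A c π`: with oracle `A`, the list `π` is an accepting computation from `c`. -/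
inductive AcceptsVia (M : Machine) (A : Lang) : Config → List Config → Prop
  | halt (c : Config) (h : c.state = M.accept) : AcceptsVia M A c [c]
  | step (c d : Config) (π : List Config) (h : M.Step A c d) (hπ : AcceptsVia M A d π) :
      AcceptsVia M A c (c :: π)

theorem acceptsVia_cons_iff {M : Machine} {A : Lang} {π : List Config} : ∀ {c d : Config},
    M.AcceptsVia A c (d :: π) ↔
      c = d ∧ (d :: π).IsChain (M.Step A) ∧
        ∃ e, (d :: π).getLast? = some e ∧ e.state = M.accept := by
  induction π with
  | nil =>
    intro c d
    constructor
    · intro h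
      cases h with
      | halt _ h => simpa using h
      | step _ _ _ _ hπ => cases hπ
    · rintro ⟨rfl, -, h⟩
      exact .halt _ (by simpa using h)
  | cons e π ih =>
    intro c d
    constructor
    · intro h
      cases h with
      | step _ _ _ h hπ =>
        obtain ⟨rfl, h1, h2⟩ := ih.1 hπ
        exact ⟨rfl, List.isChain_cons_cons.2 ⟨h, h1⟩, by simpa using h2⟩
    · rintro ⟨rfl, h1, h2⟩
      rw [List.isChain_cons_cons] at h1
      exact .step _ e _ h1.1 (ih.2 ⟨rfl, h1.2, by simpa using h2⟩)

/-- The inductive form permits case analysis on the first step of an accepting path. -/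
theorem isAcceptingPath_iff {M : Machine} {A : Lang} {x : Word} {π : List Config} :
    M.IsAcceptingPath A x π ↔ M.AcceptsVia A (M.init x) π := by
  cases π with
  | nil =>
    refine ⟨fun h => by simpa using h.1.1, fun h => by cases h⟩
  | cons d π =>
    rw [acceptsVia_cons_iff]
    simp [IsAcceptingPath, IsPath, and_assoc, eq_comm]

theorem not_step_of_accept {M : Machine} {A : Lang} {c d : Config} (h : c.state = M.accept) :
    ¬ M.Step A c d := by
  intro hs
  cases hs <;> contradiction

end Machine

/-! ### Some languages in `UP` -/

theorem univ_mem_UP (A : Lang) : Set.univ ∈ UP A := by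
  -- The start state is the accepting state, so the only path is the initial configuration.
  refine ⟨⟨0, 0, 1, 0, 0, []⟩, ⟨1, fun B x π h => ?_⟩, fun x π₁ π₂ h₁ h₂ => ?_, ?_⟩
  · obtain ⟨h1, h2⟩ := h
    match π with
    | [] => simp
    | [c] => simp
    | c :: d :: π =>
      simp only [List.head?_cons, Option.some.injEq] at h1
      subst h1
      exact absurd (List.isChain_cons_cons.1 h2).1 (Machine.not_step_of_accept rfl)
  · rw [Machine.isAcceptingPath_iff] at h₁ h₂
    cases h₁ with
    | step _ _ _ h => exact absurd h (Machine.not_step_of_accept rfl)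
    | halt => cases h₂ with
      | step _ _ _ h => exact absurd h (Machine.not_step_of_accept rfl)
      | halt => rfl
  · refine Set.eq_univ_of_forall fun x => ⟨_, Machine.isAcceptingPath_iff.2 (.halt _ rfl)⟩

/-- A machine that accepts nothing. -/
def emptyMachine : Machine := ⟨0, 1, 2, 1, 1, []⟩

theorem emptyMachine_not_step (A : Lang) (x : Word) (c : Config) :
    ¬ emptyMachine.Step A (emptyMachine.init x) c := by
  intro h
  cases h with
  | move i hacc hq hi => simp [emptyMachine] at hi
  | queryYes hacc hq => simp [emptyMachine, Machine.init] at hq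
  | queryNo hacc hq => simp [emptyMachine, Machine.init] at hq

theorem emptyMachine_not_isAcceptingPath (A : Lang) (x : Word) (π : List Config) :
    ¬ emptyMachine.IsAcceptingPath A x π := by
  rw [Machine.isAcceptingPath_iff]
  intro h
  cases h with
  | halt _ h => simp [emptyMachine, Machine.init] at h
  | step _ _ _ h => exact emptyMachine_not_step A x _ h

theorem emptyMachine_isPolyTime : emptyMachine.IsPolyTime := by
  refine ⟨1, fun B x π h => ?_⟩
  obtain ⟨h1, h2⟩ := h
  match π with
  | [] => simp
  | [c] => simp
  | c :: d :: π =>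
    simp only [List.head?_cons, Option.some.injEq] at h1
    subst h1
    exact absurd (List.isChain_cons_cons.1 h2).1 (emptyMachine_not_step B x d)

theorem emptyMachine_isUnambiguous (A : Lang) : emptyMachine.IsUnambiguous A :=
  fun x π₁ _ h => absurd h (emptyMachine_not_isAcceptingPath A x π₁)

theorem emptyMachine_language (A : Lang) : emptyMachine.language A = ∅ :=
  Set.eq_empty_of_forall_notMem fun x ⟨π, h⟩ => emptyMachine_not_isAcceptingPath A x π h

theorem empty_mem_UP (A : Lang) : ∅ ∈ UP A :=
  ⟨emptyMachine, emptyMachine_isPolyTime, emptyMachine_isUnambiguous A, emptyMachine_language A⟩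

/-- The words `x` for which the oracle contains some `y ++ [b]` with `y` as long as `x`. -/
def tagLang (A : Lang) (b : Bool) : Lang := {x | ∃ y : Word, y.length = x.length ∧ y ++ [b] ∈ A}

/-- On input `x`, this machine guesses a word `y` of the length of `x` and accepts if the oracle
contains `y ++ [b]`. -/
def tagMachine (b : Bool) : Machine where
  start := 0
  accept := 2
  query := 1
  yes := 2
  no := 3
  program :=
    [⟨0, 1, 0, 0, .right, 0, .stay, some false⟩, ⟨0, 1, 0, 0, .right, 0, .stay, some true⟩,
     ⟨0, 2, 0, 0, .right, 0, .stay, some false⟩, ⟨0, 2, 0, 0, .right, 0, .stay, some true⟩,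
     ⟨0, 0, 0, 1, .stay, 0, .stay, some b⟩]

section TagMachine

variable {A : Lang} {b : Bool} {l : List ℕ} {W : Tape} {q : Word}

theorem tagMachine_step_scan {a : Bool} {x : Word} (hW : W.read = 0) {d : Config} :
    (tagMachine b).Step A ⟨0, ⟨l, bitSymbol a :: x.map bitSymbol⟩, W, q⟩ d ↔
      ∃ g, d = ⟨0, ⟨bitSymbol a :: l, x.map bitSymbol⟩, W.act 0 .stay, q ++ [g]⟩ := by
  constructor
  · intro h
    cases h with
    | move i hacc hq hi hs hin hw =>
      simp only [tagMachine, List.mem_cons, List.not_mem_nil, or_false] at hi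
      rcases hi with rfl | rfl | rfl | rfl | rfl <;> cases a <;>
        simp_all [bitSymbol, Tape.read, Transition.apply, Tape.act]
    | queryYes hacc hq => simp [tagMachine] at hq
    | queryNo hacc hq => simp [tagMachine] at hq
  · rintro ⟨g, rfl⟩
    exact Machine.Step.move (M := tagMachine b) (A := A)
      ⟨0, ⟨l, bitSymbol a :: x.map bitSymbol⟩, W, q⟩
      ⟨0, bitSymbol a, 0, 0, .right, 0, .stay, some g⟩ (by simp [tagMachine])
      (by simp [tagMachine]) (by cases a <;> cases g <;> simp [tagMachine, bitSymbol]) rfl rfl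
      hW.symm

theorem tagMachine_step_end (hW : W.read = 0) {d : Config} :
    (tagMachine b).Step A ⟨0, ⟨l, []⟩, W, q⟩ d ↔
      d = ⟨1, ⟨l, [0]⟩, W.act 0 .stay, q ++ [b]⟩ := by
  constructor
  · intro h
    cases h with
    | move i hacc hq hi hs hin hw =>
      simp only [tagMachine, List.mem_cons, List.not_mem_nil, or_false] at hi
      rcases hi with rfl | rfl | rfl | rfl | rfl <;>
        simp_all [Tape.read, Transition.apply, Tape.act]
    | queryYes hacc hq => simp [tagMachine] at hq
    | queryNo hacc hq => simp [tagMachine] at hq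
  · rintro rfl
    exact Machine.Step.move (M := tagMachine b) (A := A) ⟨0, ⟨l, []⟩, W, q⟩
      ⟨0, 0, 0, 1, .stay, 0, .stay, some b⟩ (by simp [tagMachine])
      (by simp [tagMachine]) (by simp [tagMachine]) rfl rfl hW.symm

theorem tagMachine_step_query {t : Tape} {d : Config} :
    (tagMachine b).Step A ⟨1, t, W, q⟩ d ↔
      (q ∈ A ∧ d = ⟨2, t, W, []⟩) ∨ (q ∉ A ∧ d = ⟨3, t, W, []⟩) := by
  constructor
  · intro h
    cases h with
    | move i hacc hq => simp [tagMachine] at hq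
    | queryYes hacc hq h => exact .inl ⟨h, rfl⟩
    | queryNo hacc hq h => exact .inr ⟨h, rfl⟩
  · rintro (⟨h, rfl⟩ | ⟨h, rfl⟩)
    · exact Machine.Step.queryYes (M := tagMachine b) ⟨1, t, W, q⟩ (by simp [tagMachine]) rfl h
    · exact Machine.Step.queryNo (M := tagMachine b) ⟨1, t, W, q⟩ (by simp [tagMachine]) rfl h

theorem tagMachine_not_step_no {t : Tape} {d : Config} :
    ¬ (tagMachine b).Step A ⟨3, t, W, q⟩ d := by
  intro h
  cases h with
  | move i hacc hq hi hs hin hw =>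
    simp only [tagMachine, List.mem_cons, List.not_mem_nil, or_false] at hi
    rcases hi with rfl | rfl | rfl | rfl | rfl <;> simp at hs
  | queryYes hacc hq => simp [tagMachine] at hq
  | queryNo hacc hq => simp [tagMachine] at hq

theorem tagMachine_acceptsVia_query {t : Tape} {π : List Config} :
    (tagMachine b).AcceptsVia A ⟨1, t, W, q⟩ π ↔ q ∈ A ∧ π = [⟨1, t, W, q⟩, ⟨2, t, W, []⟩] := by
  constructor
  · intro h
    cases h with
    | halt _ h => simp [tagMachine] at h
    | step _ d π h hπ =>
      rcases tagMachine_step_query.1 h with ⟨hq, rfl⟩ | ⟨hq, rfl⟩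
      · cases hπ with
        | halt => exact ⟨hq, rfl⟩
        | step _ _ _ h => exact absurd h (Machine.not_step_of_accept rfl)
      · cases hπ with
        | halt _ h => simp [tagMachine] at h
        | step _ _ _ h => exact absurd h tagMachine_not_step_no
  · rintro ⟨h, rfl⟩
    exact .step _ _ _ (tagMachine_step_query.2 (.inl ⟨h, rfl⟩)) (.halt _ rfl)

theorem tagMachine_acceptsVia_scan {x : Word} : ∀ {l : List ℕ} {W : Tape} {q : Word},
    W.read = 0 →
    ((∃ π, (tagMachine b).AcceptsVia A ⟨0, ⟨l, x.map bitSymbol⟩, W, q⟩ π) ↔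
      ∃ y : Word, y.length = x.length ∧ q ++ y ++ [b] ∈ A) := by
  induction x with
  | nil =>
    intro l W q hW
    constructor
    · rintro ⟨π, h⟩
      cases h with
      | halt _ h => simp [tagMachine] at h
      | step _ d π h hπ =>
        obtain rfl := (tagMachine_step_end hW).1 h
        exact ⟨[], rfl, by simpa using (tagMachine_acceptsVia_query.1 hπ).1⟩
    · rintro ⟨y, hy, h⟩
      obtain rfl := List.length_eq_zero_iff.1 hy
      rw [List.append_nil] at h
      exact ⟨_, .step _ _ _ ((tagMachine_step_end hW).2 rfl)
        (tagMachine_acceptsVia_query.2 ⟨h, rfl⟩)⟩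
  | cons a x ih =>
    intro l W q hW
    constructor
    · rintro ⟨π, h⟩
      cases h with
      | halt _ h => simp [tagMachine] at h
      | step _ d π h hπ =>
        obtain ⟨g, rfl⟩ := (tagMachine_step_scan hW).1 h
        obtain ⟨y, hy, h⟩ := (ih rfl).1 ⟨π, hπ⟩
        exact ⟨g :: y, by simpa using hy, by simpa using h⟩
    · rintro ⟨y, hy, h⟩
      cases y with
      | nil => simp at hy
      | cons g y =>
        obtain ⟨π, hπ⟩ := (ih (l := bitSymbol a :: l) (W := W.act 0 .stay) (q := q ++ [g]) rfl).2
          ⟨y, by simpa using hy, by simpa using h⟩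
        exact ⟨_, .step _ _ _ ((tagMachine_step_scan hW).2 ⟨g, rfl⟩) hπ⟩

/-- An accepting path spells out, bit by bit, a word whose tagged form is in the oracle. If there is
only one such word, every guess along the path is forced. -/
theorem tagMachine_acceptsVia_unique {x : Word} : ∀ {l : List ℕ} {W : Tape} {q : Word},
    W.read = 0 →
    (∀ y z : Word, y.length = x.length → z.length = x.length → q ++ y ++ [b] ∈ A →
      q ++ z ++ [b] ∈ A → y = z) →
    ∀ {π₁ π₂ : List Config}, (tagMachine b).AcceptsVia A ⟨0, ⟨l, x.map bitSymbol⟩, W, q⟩ π₁ →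
      (tagMachine b).AcceptsVia A ⟨0, ⟨l, x.map bitSymbol⟩, W, q⟩ π₂ → π₁ = π₂ := by
  induction x with
  | nil =>
    intro l W q hW _ π₁ π₂ h₁ h₂
    cases h₁ with
    | halt _ h => simp [tagMachine] at h
    | step _ d₁ π₁ h₁ hπ₁ =>
      cases h₂ with
      | halt _ h => simp [tagMachine] at h
      | step _ d₂ π₂ h₂ hπ₂ =>
        obtain rfl := (tagMachine_step_end hW).1 h₁
        obtain rfl := (tagMachine_step_end hW).1 h₂
        rw [(tagMachine_acceptsVia_query.1 hπ₁).2, (tagMachine_acceptsVia_query.1 hπ₂).2]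
  | cons a x ih =>
    intro l W q hW hA π₁ π₂ h₁ h₂
    cases h₁ with
    | halt _ h => simp [tagMachine] at h
    | step _ d₁ π₁ h₁ hπ₁ =>
      cases h₂ with
      | halt _ h => simp [tagMachine] at h
      | step _ d₂ π₂ h₂ hπ₂ =>
        obtain ⟨g, rfl⟩ := (tagMachine_step_scan hW).1 h₁
        obtain ⟨g', rfl⟩ := (tagMachine_step_scan hW).1 h₂
        obtain ⟨y, hy, h⟩ := (tagMachine_acceptsVia_scan rfl).1 ⟨π₁, hπ₁⟩
        obtain ⟨y', hy', h'⟩ := (tagMachine_acceptsVia_scan rfl).1 ⟨π₂, hπ₂⟩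
        have hgy := hA (g :: y) (g' :: y') (by simpa using hy) (by simpa using hy')
          (by simpa using h) (by simpa using h')
        obtain ⟨rfl, rfl⟩ := List.cons_eq_cons.1 hgy
        congr 1
        refine ih rfl (fun y z hy hz hAy hAz => ?_) hπ₁ hπ₂
        simpa using hA (g :: y) (g :: z) (by simpa using hy) (by simpa using hz)
          (by simpa using hAy) (by simpa using hAz)

theorem tagMachine_length_le {x : Word} : ∀ {l : List ℕ} {W : Tape} {q : Word} {π : List Config},
    W.read = 0 →
    (Config.mk 0 ⟨l, x.map bitSymbol⟩ W q :: π).IsChain ((tagMachine b).Step A) →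
    π.length ≤ x.length + 2 := by
  induction x with
  | nil =>
    intro l W q π hW h
    match π with
    | [] => simp
    | [_] => simp
    | [_, _] => simp
    | c :: d :: e :: π =>
      simp only [List.isChain_cons_cons] at h
      obtain rfl := (tagMachine_step_end hW).1 h.1
      rcases tagMachine_step_query.1 h.2.1 with ⟨-, rfl⟩ | ⟨-, rfl⟩
      · exact absurd h.2.2.1 (Machine.not_step_of_accept rfl)
      · exact absurd h.2.2.1 tagMachine_not_step_no
  | cons a x ih =>
    intro l W q π hW h
    match π with
    | [] => simp
    | c :: π =>
      rw [List.isChain_cons_cons] at h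
      obtain ⟨g, rfl⟩ := (tagMachine_step_scan hW).1 h.1
      have := ih rfl h.2
      simp only [List.length_cons]
      omega

theorem tagMachine_isPolyTime : (tagMachine b).IsPolyTime := by
  -- One step per input bit, one to append the tag and one to query: at most |x| + 3 configurations.
  refine ⟨Polynomial.X + 3, fun B x π h => ?_⟩
  obtain ⟨h1, h2⟩ := h
  cases π with
  | nil => simp
  | cons c π =>
    simp only [List.head?_cons, Option.some.injEq] at h1
    subst h1
    have := tagMachine_length_le (x := x) rfl h2
    simp only [List.length_cons, Polynomial.eval_add, Polynomial.eval_X, Polynomial.eval_ofNat]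
    omega

theorem tagMachine_language : (tagMachine b).language A = tagLang A b := by
  ext x
  simp only [Machine.language, Machine.isAcceptingPath_iff, Set.mem_ofPred_eq, tagLang]
  exact tagMachine_acceptsVia_scan (q := []) rfl

theorem tagLang_mem_UP
    (hA : ∀ y z : Word, y.length = z.length → y ++ [b] ∈ A → z ++ [b] ∈ A → y = z) :
    tagLang A b ∈ UP A := by
  refine ⟨tagMachine b, tagMachine_isPolyTime, fun x π₁ π₂ h₁ h₂ => ?_, tagMachine_language⟩
  rw [Machine.isAcceptingPath_iff] at h₁ h₂
  exact tagMachine_acceptsVia_unique (x := x) (q := []) rfl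
    (fun y z hy hz => hA y z (hy.trans hz.symm)) h₁ h₂

end TagMachine

/-! ### Unions of differences -/

/-- A list of pairs of a list of machines and a machine; the pair `(Ms, N)` stands for the words
that all machines in `Ms` accept and `N` rejects, and the whole list for the union of these. -/
abbrev Combination := List (List Machine × Machine)

namespace Combination

/-- The value of a combination, given the machines that accept. -/
def Holds (R : Combination) (p : Machine → Prop) : Prop :=
  ∃ r ∈ R, (∀ M ∈ r.1, p M) ∧ ¬ p r.2

/-- The machines that occur in a combination. -/
def machines (R : Combination) : List Machine := R.flatMap fun r => r.2 :: r.1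

/-- The language that a combination stands for. -/
def language (R : Combination) (A : Lang) : Lang := {x | R.Holds fun M => x ∈ M.language A}

theorem mem_machines {R : Combination} {M : Machine} :
    M ∈ R.machines ↔ ∃ r ∈ R, M = r.2 ∨ M ∈ r.1 := by
  simp [machines]

theorem Holds.congr {R : Combination} {p q : Machine → Prop}
    (h : ∀ M ∈ R.machines, (p M ↔ q M)) : R.Holds p ↔ R.Holds q := by
  refine exists_congr fun r => and_congr_right fun hr => and_congr ?_ (not_congr ?_)
  · exact forall₂_congr fun M hM => h M (mem_machines.2 ⟨r, hr, .inr hM⟩)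
  · exact h _ (mem_machines.2 ⟨r, hr, .inl rfl⟩)

/-- All machines of the combination are `UP` machines relative to `A`. -/
def IsUP (R : Combination) (A : Lang) : Prop :=
  ∀ M ∈ R.machines, M.IsPolyTime ∧ M.IsUnambiguous A

end Combination

theorem exists_combination_UP {A L : Lang} (h : L ∈ UP A) :
    ∃ R : Combination, R.IsUP A ∧ R.language A = L := by
  obtain ⟨M, h1, h2, rfl⟩ := h
  -- L = L \ ∅.
  refine ⟨[([M], emptyMachine)], ?_, ?_⟩
  · simp [Combination.IsUP, Combination.machines, h1, h2, emptyMachine_isPolyTime,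
      emptyMachine_isUnambiguous]
  · ext x
    simp [Combination.language, Combination.Holds, emptyMachine_language]

theorem exists_combination_diff {A L : Lang} (h : L ∈ classDiff (UP A) (UP A)) :
    ∃ M N : Machine, (M.IsPolyTime ∧ M.IsUnambiguous A) ∧ (N.IsPolyTime ∧ N.IsUnambiguous A) ∧
      L = M.language A \ N.language A := by
  obtain ⟨_, ⟨M, h1, h2, rfl⟩, _, ⟨N, h3, h4, rfl⟩, rfl⟩ := h
  exact ⟨M, N, ⟨h1, h2⟩, ⟨h3, h4⟩, rfl⟩

theorem exists_combination_E {A : Lang} : ∀ {k : ℕ} {L : Lang}, L ∈ E (UP A) k →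
    ∃ R : Combination, R.IsUP A ∧ R.language A = L
  | 0, L, h => absurd h (Set.notMem_empty L)
  | 1, L, h => exists_combination_UP h
  | 2, L, h => by
    obtain ⟨M, N, hM, hN, rfl⟩ := exists_combination_diff h
    refine ⟨[([M], N)], by simp [Combination.IsUP, Combination.machines, hM, hN], ?_⟩
    ext x
    simp [Combination.language, Combination.Holds]
  | k + 3, L, h => by
    obtain ⟨L₁, h₁, L₂, h₂, rfl⟩ := h
    obtain ⟨M, N, hM, hN, rfl⟩ := exists_combination_diff h₁
    obtain ⟨R, hR, rfl⟩ := exists_combination_E h₂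
    refine ⟨([M], N) :: R, ?_, ?_⟩
    · intro K hK
      simp only [Combination.machines, List.flatMap_cons, List.mem_append, List.mem_cons,
        List.not_mem_nil, or_false] at hK
      rcases hK with (rfl | rfl) | hK
      exacts [hN, hM, hR K hK]
    · ext x
      simp [Combination.language, Combination.Holds]

/-- Uses M \ (N \ L') = (M \ N) ∪ (M ∩ L'). Intersecting with M prepends it to the list of each
pair; keeping lists makes it unnecessary to construct machines for intersections. -/
theorem exists_combination_D {A : Lang} : ∀ {k : ℕ} {L : Lang}, L ∈ D (UP A) k →
    ∃ R : Combination, R.IsUP A ∧ R.language A = L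
  | 0, L, h => absurd h (Set.notMem_empty L)
  | 1, L, h => exists_combination_UP h
  | 2, L, h => exists_combination_E (k := 2) h
  | k + 3, L, h => by
    obtain ⟨_, ⟨M, hM, hM', rfl⟩, _, ⟨_, ⟨N, hN, hN', rfl⟩, L', h', rfl⟩, rfl⟩ := h
    obtain ⟨R, hR, rfl⟩ := exists_combination_D h'
    refine ⟨([M], N) :: R.map fun r => (M :: r.1, r.2), ?_, ?_⟩
    · intro K hK
      obtain ⟨r, hr, hK⟩ := Combination.mem_machines.1 hK
      rcases List.mem_cons.1 hr with rfl | hr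
      · rcases hK with rfl | hK
        · exact ⟨hN, hN'⟩
        · obtain rfl := List.mem_singleton.1 hK
          exact ⟨hM, hM'⟩
      · obtain ⟨r, hr₀, rfl⟩ := List.mem_map.1 hr
        rcases hK with rfl | hK
        · exact hR _ (Combination.mem_machines.2 ⟨r, hr₀, .inl rfl⟩)
        · rcases List.mem_cons.1 hK with rfl | hK
          · exact ⟨hM, hM'⟩
          · exact hR _ (Combination.mem_machines.2 ⟨r, hr₀, .inr hK⟩)
    · ext x
      simp only [Combination.language, Combination.Holds, Set.mem_sdiff, Set.mem_ofPred_eq,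
        List.mem_cons, List.mem_map, exists_eq_or_imp, List.not_mem_nil, or_false, forall_eq,
        exists_exists_and_eq_and, forall_eq_or_imp]
      grind

/-! ### The combinatorial core -/

/-- By injectivity each list rules out at most m partners, so at most 2m|α| < |α|² pairs are bad. -/
theorem exists_avoiding_pair {α β : Type*} [Fintype α] [DecidableEq β] {f g : α → β}
    (hf : f.Injective) (hg : g.Injective) (F G : α → List β) {m : ℕ}
    (hF : ∀ a, (F a).length ≤ m) (hG : ∀ a, (G a).length ≤ m) (hm : 2 * m < Fintype.card α) :
    ∃ a b, g b ∉ F a ∧ f a ∉ G b := by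
  classical
  by_contra! h
  have key : ∀ (e : α → β) (he : e.Injective) (l : List β), l.length ≤ m →
      (Finset.univ.filter fun a => e a ∈ l).card ≤ m := by
    intro e he l hl
    refine le_trans ?_ ((List.toFinset_card_le l).trans hl)
    refine Finset.card_le_card_of_injOn e ?_ he.injOn
    intro a ha
    simpa using ha
  have h1 : (Finset.univ.filter fun p : α × α => g p.2 ∈ F p.1).card ≤ Fintype.card α * m := by
    rw [← Finset.card_univ, ← Finset.sum_const_nat (m := m) (f := fun _ : α => m) (by simp)]
    rw [Finset.card_filter, Finset.univ_product_univ.symm, Finset.sum_product]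
    refine Finset.sum_le_sum fun a _ => ?_
    rw [← Finset.card_filter]
    exact key g hg _ (hF a)
  have h2 : (Finset.univ.filter fun p : α × α => f p.1 ∈ G p.2).card ≤ Fintype.card α * m := by
    rw [← Finset.card_univ, ← Finset.sum_const_nat (m := m) (f := fun _ : α => m) (by simp)]
    rw [Finset.card_filter, Finset.univ_product_univ.symm, Finset.sum_product_right]
    refine Finset.sum_le_sum fun a _ => ?_
    rw [← Finset.card_filter]
    exact key f hf _ (hG a)
  have h3 : (Finset.univ : Finset (α × α)) ⊆ (Finset.univ.filter fun p => g p.2 ∈ F p.1) ∪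
      Finset.univ.filter fun p => f p.1 ∈ G p.2 := by
    rintro ⟨a, b⟩ -
    by_cases hab : g b ∈ F a
    · simp [hab]
    · simp [h a b hab]
  have h4 := (Finset.card_le_card h3).trans (Finset.card_union_le _ _)
  rw [Finset.card_univ, Fintype.card_prod] at h4
  have h5 : Fintype.card α * Fintype.card α ≤ Fintype.card α * (2 * m) := by linarith
  have h6 : 0 < Fintype.card α := by omega
  exact absurd (Nat.le_of_mul_le_mul_left h5 h6) (by omega)

/-! ### Accepting paths that avoid given words -/

namespace Machine

open Classical in
/-- The contents of the oracle tape along some accepting path, if there is one. -/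
noncomputable def witnessWords (M : Machine) (A : Lang) (x : Word) : List Word :=
  if h : ∃ π, M.IsAcceptingPath A x π then h.choose.map Config.asked else []

theorem exists_path_witnessWords {M : Machine} {A : Lang} {x : Word} (h : x ∈ M.language A) :
    ∃ π, M.IsAcceptingPath A x π ∧ M.witnessWords A x = π.map Config.asked := by
  have h' : ∃ π, M.IsAcceptingPath A x π := h
  exact ⟨h'.choose, h'.choose_spec, by rw [witnessWords, dif_pos h']⟩

theorem witnessWords_length_le {M : Machine} {A : Lang} {x : Word} {w : ℕ}
    (h : ∀ π, M.IsPath A x π → π.length ≤ w) : (M.witnessWords A x).length ≤ w := by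
  by_cases hx : x ∈ M.language A
  · obtain ⟨π, hπ, e⟩ := exists_path_witnessWords hx
    rw [e, List.length_map]
    exact h π hπ.1
  · have hx' : ¬ ∃ π, M.IsAcceptingPath A x π := hx
    rw [witnessWords, dif_neg hx']
    exact Nat.zero_le w

theorem mem_language_of_agree {M : Machine} {A B : Lang} {x : Word} (h : x ∈ M.language A)
    (hAB : ∀ q ∈ M.witnessWords A x, (q ∈ A ↔ q ∈ B)) : x ∈ M.language B := by
  obtain ⟨π, hπ, e⟩ := exists_path_witnessWords h
  exact ⟨π, hπ.congr fun c hc => hAB _ (e ▸ List.mem_map_of_mem hc)⟩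

/-- If `M` is unambiguous on `x` with `u` and `v` added to the oracle, and the chosen accepting
paths with only one of them added do not look at the other, then `M` accepts without them. -/
theorem mem_language_of_mem_insert {M : Machine} {B : Lang} {x u v : Word}
    (hM : ∀ π₁ π₂, M.IsAcceptingPath (insert u (insert v B)) x π₁ →
      M.IsAcceptingPath (insert u (insert v B)) x π₂ → π₁ = π₂)
    (hu : x ∈ M.language (insert u B)) (hv : x ∈ M.language (insert v B))
    (hvu : v ∉ M.witnessWords (insert u B) x) (huv : u ∉ M.witnessWords (insert v B) x) :
    x ∈ M.language B := by
  obtain ⟨π₁, h₁, e₁⟩ := exists_path_witnessWords hu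
  obtain ⟨π₂, h₂, e₂⟩ := exists_path_witnessWords hv
  have hv' : ∀ c ∈ π₁, c.asked ≠ v := fun c hc h => hvu (e₁ ▸ h ▸ List.mem_map_of_mem hc)
  have hu' : ∀ c ∈ π₂, c.asked ≠ u := fun c hc h => huv (e₂ ▸ h ▸ List.mem_map_of_mem hc)
  -- Each path ignores the word missing from its own oracle, so both remain accepting when both
  -- words are present.
  have h := hM π₁ π₂ (h₁.congr fun c hc => by simp [hv' c hc])
    (h₂.congr fun c hc => by simp [hu' c hc])
  subst h
  -- The common path also inherits from π₂ that it does not query u.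
  exact ⟨π₁, h₁.congr fun c hc => by simp [hu' c hc]⟩

end Machine

/-- For few machines that are unambiguous on `x` whenever at most one word of the form `y ++ [b]`
with `y` of length `n` is added to the oracle for each `b`, there are two such words that keep
accepting machines accepting when one of them is added, and of which at most one alone makes a
rejecting machine accept. -/
theorem exists_robust_pair {ms : List Machine} {B : Lang} {x : Word} {n w : ℕ}
    (hw : ∀ M ∈ ms, ∀ (A : Lang) (π : List Config), M.IsPath A x π → π.length ≤ w)
    (hn : 4 * (ms.length * w) < 2 ^ n)
    (hM : ∀ M ∈ ms, ∀ y z : Word, y.length = n → z.length = n → ∀ π₁ π₂,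
      M.IsAcceptingPath (insert (y ++ [false]) (insert (z ++ [true]) B)) x π₁ →
      M.IsAcceptingPath (insert (y ++ [false]) (insert (z ++ [true]) B)) x π₂ → π₁ = π₂) :
    ∃ y z : Word, y.length = n ∧ z.length = n ∧ ∀ M ∈ ms,
      (x ∈ M.language B → x ∈ M.language (insert (y ++ [false]) B) ∧
        x ∈ M.language (insert (z ++ [true]) B)) ∧
      (x ∈ M.language (insert (y ++ [false]) B) → x ∈ M.language (insert (z ++ [true]) B) →
        x ∈ M.language B) := by
  let f : Bool → (Fin n → Bool) → Word := fun b a => List.ofFn a ++ [b]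
  have hf : ∀ b, (f b).Injective := fun b a a' h =>
    List.ofFn_injective (List.append_cancel_right h)
  -- The first half protects acceptance over `B`; the second keeps the path found after one
  -- insertion away from the other word. Two lists of length at most w per machine, and the factor 2
  -- in `exists_avoiding_pair`, give the 4 in `hn`.
  let F : Bool → (Fin n → Bool) → List Word := fun b a =>
    ms.flatMap fun M => M.witnessWords B x ++ M.witnessWords (insert (f b a) B) x
  have hF : ∀ b a, (F b a).length ≤ 2 * (ms.length * w) := by
    intro b a
    have : ∀ l : List Machine, (∀ M ∈ l, M ∈ ms) →
        (l.flatMap fun M => M.witnessWords B x ++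
          M.witnessWords (insert (f b a) B) x).length ≤ 2 * (l.length * w) := by
      intro l
      induction l with
      | nil => simp
      | cons M l ih =>
        intro hl
        have h1 := ih fun N hN => hl N (List.mem_cons_of_mem _ hN)
        have hM' := hw M (hl M List.mem_cons_self)
        have h2 := Machine.witnessWords_length_le (hM' B)
        have h3 := Machine.witnessWords_length_le (hM' (insert (f b a) B))
        simp only [List.flatMap_cons, List.length_append, List.length_cons, Nat.add_mul] at h1 ⊢
        omega
    exact this ms fun _ h => h
  obtain ⟨a, a', h1, h2⟩ := exists_avoiding_pair (hf false) (hf true) (F false) (F true)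
    (hF false) (hF true) (by
      rw [Fintype.card_fun, Fintype.card_bool, Fintype.card_fin]
      omega)
  simp only [F, List.mem_flatMap, List.mem_append, not_exists, not_and, not_or] at h1 h2
  refine ⟨List.ofFn a, List.ofFn a', by simp, by simp, fun M hMs => ⟨fun hx => ⟨?_, ?_⟩, ?_⟩⟩
  · refine Machine.mem_language_of_agree hx fun q hq => ?_
    have : q ≠ f false a := fun h => (h2 M hMs).1 (h ▸ hq)
    simp only [Set.mem_insert_iff]
    exact (or_iff_right this).symm
  · refine Machine.mem_language_of_agree hx fun q hq => ?_
    have : q ≠ f true a' := fun h => (h1 M hMs).1 (h ▸ hq)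
    simp only [Set.mem_insert_iff]
    exact (or_iff_right this).symm
  · exact fun hy hz => Machine.mem_language_of_mem_insert
      (hM M hMs _ _ (by simp) (by simp)) hy hz (h1 M hMs).2 (h2 M hMs).2

/-! ### Simulation of machines with a finite oracle -/

/-- The configurations that `M` can go to from `c` with the finite oracle `σ`. -/
def succs (M : Machine) (σ : List Word) (c : Config) : List Config :=
  if c.state = M.accept then []
  else if c.state = M.query then
    [{ c with state := if c.asked ∈ σ then M.yes else M.no, asked := [] }]
  else (M.program.filter fun i =>
    i.state = c.state ∧ i.readInput = c.input.read ∧ i.readWork = c.work.read).map (·.apply c)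

/-- The oracle that consists of the words in a list. -/
def oracleOf (σ : List Word) : Lang := {w | w ∈ σ}

theorem mem_succs {M : Machine} {σ : List Word} {c d : Config} :
    d ∈ succs M σ c ↔ M.Step (oracleOf σ) c d := by
  unfold succs
  constructor
  · intro h
    split_ifs at h with h1 h2 h3
    · simp at h
    · obtain rfl := List.mem_singleton.1 h
      exact .queryYes c h1 h2 h3
    · obtain rfl := List.mem_singleton.1 h
      exact .queryNo c h1 h2 h3
    · obtain ⟨i, hi, rfl⟩ := List.mem_map.1 h
      simp only [List.mem_filter, decide_eq_true_eq] at hi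
      exact .move c i h1 h2 hi.1 hi.2.1 hi.2.2.1 hi.2.2.2
  · intro h
    cases h with
    | move i hacc hq hi hs hin hw =>
      rw [if_neg hacc, if_neg hq]
      exact List.mem_map.2 ⟨i, by simp [hi, hs, hin, hw], rfl⟩
    | queryYes hacc hq h =>
      have h' : c.asked ∈ σ := h
      rw [if_neg hacc, if_pos hq, if_pos h']
      exact List.mem_singleton.2 rfl
    | queryNo hacc hq h =>
      have h' : c.asked ∉ σ := h
      rw [if_neg hacc, if_pos hq, if_neg h']
      exact List.mem_singleton.2 rfl

/-- All ways to extend a computation path, given in reverse, by one step; an accepting path is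
kept. -/
def extend (M : Machine) (σ : List Word) (π : List Config) : List (List Config) :=
  π.head?.toList.flatMap fun c =>
    if c.state = M.accept then [π] else (succs M σ c).map fun d => d :: π

/-- The computation paths of `M` on `x` after `t` steps, in reverse. -/
def runs (M : Machine) (σ : List Word) (x : Word) (t : ℕ) : List (List Config) :=
  (fun P => P.flatMap (extend M σ))^[t] [[M.init x]]

/-- The accepting ones among the computation paths of `M` on `x` of at most `t` steps, in
reverse. -/
def acceptingRuns (M : Machine) (σ : List Word) (x : Word) (t : ℕ) : List (List Config) :=
  (runs M σ x t).filter fun π => ∃ c ∈ π.head?.toList, c.state = M.accept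

theorem runs_succ (M : Machine) (σ : List Word) (x : Word) (t : ℕ) :
    runs M σ x (t + 1) = (runs M σ x t).flatMap (extend M σ) :=
  Function.iterate_succ_apply' _ _ _

theorem isPath_of_mem_runs {M : Machine} {σ : List Word} {x : Word} {t : ℕ} :
    ∀ {π : List Config}, π ∈ runs M σ x t → M.IsPath (oracleOf σ) x π.reverse := by
  induction t with
  | zero =>
    intro π h
    obtain rfl := List.mem_singleton.1 h
    exact ⟨rfl, by simp⟩
  | succ t ih =>
    intro π h
    rw [runs_succ, List.mem_flatMap] at h
    obtain ⟨ρ, hρ, h⟩ := h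
    have hρ' := ih hρ
    cases ρ with
    | nil => simp [extend] at h
    | cons c ρ =>
      simp only [extend, List.head?_cons, Option.toList_some, List.flatMap_cons,
        List.flatMap_nil, List.append_nil] at h
      split_ifs at h with h1
      · obtain rfl := List.mem_singleton.1 h
        exact hρ'
      · obtain ⟨d, hd, rfl⟩ := List.mem_map.1 h
        refine ⟨?_, ?_⟩
        · rw [List.reverse_cons, List.head?_append, hρ'.1]
          rfl
        · have h2 := hρ'.2
          rw [List.isChain_reverse] at h2 ⊢
          exact List.isChain_cons_cons.2 ⟨mem_succs.1 hd, h2⟩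

theorem mem_runs_of_isPath {M : Machine} {σ : List Word} {x : Word} {t : ℕ} :
    ∀ {π : List Config}, M.IsPath (oracleOf σ) x π.reverse → π.length = t + 1 →
      π ∈ runs M σ x t := by
  induction t with
  | zero =>
    intro π h hπ
    obtain ⟨c, rfl⟩ := List.length_eq_one_iff.1 hπ
    have h1 := h.1
    simp only [List.reverse_singleton, List.head?_cons, Option.some.injEq] at h1
    subst h1
    exact List.mem_singleton.2 rfl
  | succ t ih =>
    intro π h hπ
    match π with
    | d :: c :: π =>
      have h2 := h.2
      rw [List.isChain_reverse] at h2
      have h3 := List.isChain_cons_cons.1 h2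
      have hstep : M.Step (oracleOf σ) c d := h3.1
      have hc : c.state ≠ M.accept := fun hc => Machine.not_step_of_accept hc hstep
      rw [runs_succ, List.mem_flatMap]
      refine ⟨c :: π, ih ⟨?_, by rw [List.isChain_reverse]; exact h3.2⟩ (by simpa using hπ), ?_⟩
      · have h1 := h.1
        rw [List.reverse_cons, List.head?_append_of_ne_nil _ (by simp)] at h1
        exact h1
      · simpa [extend, hc] using mem_succs.2 hstep

/-- If t bounds all path lengths, the clocked simulation misses nothing. Paths are stored in reverse
so that a step is a `cons`. -/
theorem mem_acceptingRuns {M : Machine} {σ : List Word} {x : Word} {t : ℕ}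
    (ht : ∀ π, M.IsPath (oracleOf σ) x π → π.length ≤ t) {π : List Config} :
    π ∈ acceptingRuns M σ x t ↔ M.IsAcceptingPath (oracleOf σ) x π.reverse := by
  simp only [acceptingRuns, List.mem_filter, decide_eq_true_eq, Option.mem_toList,
    Machine.IsAcceptingPath, List.getLast?_reverse]
  constructor
  · rintro ⟨h1, h2⟩
    exact ⟨isPath_of_mem_runs h1, h2⟩
  · rintro ⟨h1, c, h2, hc⟩
    refine ⟨?_, c, h2, hc⟩
    have hlen := ht _ h1
    rw [List.length_reverse] at hlen
    have hpos : π ≠ [] := by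
      rintro rfl
      simp at h2
    obtain ⟨s, hs⟩ : ∃ s, π.length = s + 1 :=
      Nat.exists_eq_succ_of_ne_zero (by simpa using hpos)
    have hmem := mem_runs_of_isPath h1 hs
    -- The path appears after s steps, and `extend` retains accepting paths, so it is still present
    -- at time t.
    have hkeep : ∀ k, π ∈ runs M σ x (s + k) := by
      intro k
      induction k with
      | zero => exact hmem
      | succ k ih =>
        rw [← Nat.add_assoc, runs_succ, List.mem_flatMap]
        exact ⟨π, ih, by simp [extend, h2, hc]⟩
    obtain ⟨k, rfl⟩ : ∃ k, t = s + k := ⟨t - s, by omega⟩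
    exact hkeep k

/-- Some accepting path of at most `t` steps. -/
def AcceptsIn (M : Machine) (σ : List Word) (x : Word) (t : ℕ) : Prop :=
  acceptingRuns M σ x t ≠ []

/-- Two accepting paths of at most `t` steps. -/
def AmbiguousIn (M : Machine) (σ : List Word) (x : Word) (t : ℕ) : Prop :=
  ∃ π₁ ∈ acceptingRuns M σ x t, ∃ π₂ ∈ acceptingRuns M σ x t, π₁ ≠ π₂

theorem acceptsIn_iff {M : Machine} {σ : List Word} {x : Word} {t : ℕ}
    (ht : ∀ π, M.IsPath (oracleOf σ) x π → π.length ≤ t) :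
    AcceptsIn M σ x t ↔ x ∈ M.language (oracleOf σ) := by
  simp only [AcceptsIn, ne_eq, List.eq_nil_iff_forall_not_mem, not_forall, not_not,
    mem_acceptingRuns ht]
  exact ⟨fun ⟨π, h⟩ => ⟨_, h⟩, fun ⟨π, h⟩ => ⟨π.reverse, by rwa [List.reverse_reverse]⟩⟩

theorem ambiguousIn_iff {M : Machine} {σ : List Word} {x : Word} {t : ℕ}
    (ht : ∀ π, M.IsPath (oracleOf σ) x π → π.length ≤ t) :
    AmbiguousIn M σ x t ↔ ∃ π₁ π₂, M.IsAcceptingPath (oracleOf σ) x π₁ ∧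
      M.IsAcceptingPath (oracleOf σ) x π₂ ∧ π₁ ≠ π₂ := by
  simp only [AmbiguousIn, mem_acceptingRuns ht]
  constructor
  · rintro ⟨π₁, h₁, π₂, h₂, h⟩
    exact ⟨_, _, h₁, h₂, fun h' => h (List.reverse_injective h')⟩
  · rintro ⟨π₁, π₂, h₁, h₂, h⟩
    exact ⟨π₁.reverse, by rwa [List.reverse_reverse], π₂.reverse, by rwa [List.reverse_reverse],
      fun h' => h (List.reverse_injective h')⟩

/-! ### The simulation is primitive recursive -/

section Primrec

open Primrec

def moveEquiv : Move ≃ Fin 3 where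
  toFun | .left => 0 | .stay => 1 | .right => 2
  invFun | 0 => .left | 1 => .stay | 2 => .right
  left_inv m := by cases m <;> rfl
  right_inv i := by fin_cases i <;> rfl

def tapeEquiv : Tape ≃ List ℕ × List ℕ where
  toFun t := (t.left, t.right)
  invFun p := ⟨p.1, p.2⟩
  left_inv _ := rfl
  right_inv _ := rfl

instance : Primcodable Move := Primcodable.ofEquiv _ moveEquiv

instance : Primcodable Tape := Primcodable.ofEquiv _ tapeEquiv

def transitionEquiv :
    Transition ≃ ℕ × ℕ × ℕ × ℕ × Move × ℕ × Move × Option Bool where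
  toFun i := (i.state, i.readInput, i.readWork, i.next, i.moveInput, i.writeWork, i.moveWork, i.ask)
  invFun p := ⟨p.1, p.2.1, p.2.2.1, p.2.2.2.1, p.2.2.2.2.1, p.2.2.2.2.2.1, p.2.2.2.2.2.2.1,
    p.2.2.2.2.2.2.2⟩
  left_inv _ := rfl
  right_inv _ := rfl

instance : Primcodable Transition := Primcodable.ofEquiv _ transitionEquiv

def machineEquiv : Machine ≃ ℕ × ℕ × ℕ × ℕ × ℕ × List Transition where
  toFun M := (M.start, M.accept, M.query, M.yes, M.no, M.program)
  invFun p := ⟨p.1, p.2.1, p.2.2.1, p.2.2.2.1, p.2.2.2.2.1, p.2.2.2.2.2⟩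
  left_inv _ := rfl
  right_inv _ := rfl

instance : Primcodable Machine := Primcodable.ofEquiv _ machineEquiv

def configEquiv : Config ≃ ℕ × Tape × Tape × Word where
  toFun c := (c.state, c.input, c.work, c.asked)
  invFun p := ⟨p.1, p.2.1, p.2.2.1, p.2.2.2⟩
  left_inv _ := rfl
  right_inv _ := rfl

instance : Primcodable Config := Primcodable.ofEquiv _ configEquiv

variable {α β : Type*} [Primcodable α] [Primcodable β]

theorem primrec_tapeLeft : Primrec Tape.left := fst.comp (of_equiv (e := tapeEquiv))

theorem primrec_tapeRight : Primrec Tape.right := snd.comp (of_equiv (e := tapeEquiv))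

theorem primrec_tapeMk {f g : α → List ℕ} (hf : Primrec f) (hg : Primrec g) :
    Primrec fun a => Tape.mk (f a) (g a) :=
  (of_equiv_symm (e := tapeEquiv)).comp (hf.pair hg)

theorem primrec_headD : Primrec fun l : List ℕ => l.headD 0 :=
  (option_getD.comp list_head? (const 0)).of_eq fun l => by cases l <;> rfl

theorem primrec_read : Primrec Tape.read := primrec_headD.comp primrec_tapeRight

theorem primrec_act {f : α → Tape} {g : α → ℕ} {m : α → Move} (hf : Primrec f) (hg : Primrec g)
    (hm : Primrec m) : Primrec fun a => (f a).act (g a) (m a) := by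
  have hl := primrec_tapeLeft.comp hf
  have hr := list_tail.comp (primrec_tapeRight.comp hf)
  have hc := list_cons.comp hg hr
  refine (ite (Primrec.eq.comp hm (const Move.left))
    (primrec_tapeMk (list_tail.comp hl) (list_cons.comp (primrec_headD.comp hl) hc))
    (ite (Primrec.eq.comp hm (const Move.stay)) (primrec_tapeMk hl hc)
      (primrec_tapeMk (list_cons.comp hg hl) hr))).of_eq fun a => ?_
  cases h : m a <;> simp [Tape.act]

theorem primrec_configState : Primrec fun c : Config => c.state :=
  fst.comp (of_equiv (e := configEquiv))

theorem primrec_configInput : Primrec fun c : Config => c.input :=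
  (fst.comp snd).comp (of_equiv (e := configEquiv))

theorem primrec_configWork : Primrec fun c : Config => c.work :=
  (fst.comp (snd.comp snd)).comp (of_equiv (e := configEquiv))

theorem primrec_configAsked : Primrec fun c : Config => c.asked :=
  (snd.comp (snd.comp snd)).comp (of_equiv (e := configEquiv))

theorem primrec_configMk {s : α → ℕ} {f g : α → Tape} {q : α → Word} (hs : Primrec s)
    (hf : Primrec f) (hg : Primrec g) (hq : Primrec q) :
    Primrec fun a => Config.mk (s a) (f a) (g a) (q a) :=
  (of_equiv_symm (e := configEquiv)).comp (hs.pair (hf.pair (hg.pair hq)))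

theorem primrec_transition {f : α → Transition} (hf : Primrec f) :
    Primrec fun a => transitionEquiv (f a) :=
  of_equiv.comp hf

theorem primrec_machine {f : α → Machine} (hf : Primrec f) : Primrec fun a => machineEquiv (f a) :=
  of_equiv.comp hf

theorem primrec_machineStart {f : α → Machine} (hf : Primrec f) : Primrec fun a => (f a).start :=
  fst.comp (primrec_machine hf)

theorem primrec_machineAccept {f : α → Machine} (hf : Primrec f) : Primrec fun a => (f a).accept :=
  fst.comp (snd.comp (primrec_machine hf))

theorem primrec_machineQuery {f : α → Machine} (hf : Primrec f) : Primrec fun a => (f a).query :=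
  fst.comp (snd.comp (snd.comp (primrec_machine hf)))

theorem primrec_machineYes {f : α → Machine} (hf : Primrec f) : Primrec fun a => (f a).yes :=
  fst.comp (snd.comp (snd.comp (snd.comp (primrec_machine hf))))

theorem primrec_machineNo {f : α → Machine} (hf : Primrec f) : Primrec fun a => (f a).no :=
  fst.comp (snd.comp (snd.comp (snd.comp (snd.comp (primrec_machine hf)))))

theorem primrec_machineProgram {f : α → Machine} (hf : Primrec f) : Primrec fun a => (f a).program :=
  snd.comp (snd.comp (snd.comp (snd.comp (snd.comp (primrec_machine hf)))))

theorem primrec_init {f : α → Machine} (hf : Primrec f) {x : α → Word} (hx : Primrec x) :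
    Primrec fun a => (f a).init (x a) := by
  have hb : Primrec₂ fun (_ : α) (b : Bool) => bitSymbol b := (dom_bool bitSymbol).comp snd
  exact primrec_configMk (primrec_machineStart hf)
    (primrec_tapeMk (const []) (list_map hx hb)) (const (Tape.mk [] [])) (const [])

theorem primrec_apply {i : α → Transition} {c : α → Config} (hi : Primrec i) (hc : Primrec c) :
    Primrec fun a => (i a).apply (c a) := by
  have h1 := snd.comp (snd.comp (snd.comp (primrec_transition hi)))
  have h2 := snd.comp h1
  have h3 := snd.comp h2
  have h4 := snd.comp h3
  have hin := primrec_configInput.comp hc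
  have hwork := primrec_configWork.comp hc
  have hasked := primrec_configAsked.comp hc
  exact primrec_configMk (fst.comp h1) (primrec_act hin (primrec_read.comp hin) (fst.comp h2))
    (primrec_act hwork (fst.comp h3) (fst.comp h4))
    (list_append.comp hasked (optionToList.comp (snd.comp h4)))

theorem primrecRel_mem [DecidableEq β] : PrimrecRel fun (l : List β) (b : β) => b ∈ l :=
  (Primrec.eq.exists_mem_list (α := β)).of_eq fun l b => by simp

theorem primrecPred_matches {i : α → Transition} {c : α → Config} (hi : Primrec i)
    (hc : Primrec c) : PrimrecPred fun a => (i a).state = (c a).state ∧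
      (i a).readInput = (c a).input.read ∧ (i a).readWork = (c a).work.read := by
  have h := primrec_transition hi
  have h1 := snd.comp h
  exact (Primrec.eq.comp (fst.comp h) (primrec_configState.comp hc)).and
    ((Primrec.eq.comp (fst.comp h1) (primrec_read.comp (primrec_configInput.comp hc))).and
      (Primrec.eq.comp (fst.comp (snd.comp h1)) (primrec_read.comp (primrec_configWork.comp hc))))

theorem primrecRel_matches : PrimrecRel fun (i : Transition) (c : Config) =>
    i.state = c.state ∧ i.readInput = c.input.read ∧ i.readWork = c.work.read :=
  primrecPred_matches fst snd

theorem primrec_succs {m : α → Machine} {s : α → List Word} {c : α → Config} (hm : Primrec m)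
    (hs : Primrec s) (hc : Primrec c) : Primrec fun a => succs (m a) (s a) (c a) := by
  have hstate := primrec_configState.comp hc
  have hin := primrec_configInput.comp hc
  have hwork := primrec_configWork.comp hc
  have hasked := primrec_configAsked.comp hc
  refine ite (Primrec.eq.comp hstate (primrec_machineAccept hm)) (const [])
    (ite (Primrec.eq.comp hstate (primrec_machineQuery hm)) ?_ ?_)
  · exact list_cons.comp (primrec_configMk (ite (primrecRel_mem.comp hs hasked)
      (primrec_machineYes hm) (primrec_machineNo hm)) hin hwork (const [])) (const [])
  · exact list_map (primrecRel_matches.listFilter.comp (primrec_machineProgram hm) hc)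
      (primrec_apply snd (hc.comp fst))

theorem primrec_extend {m : α → Machine} {s : α → List Word} {p : α → List Config}
    (hm : Primrec m) (hs : Primrec s) (hp : Primrec p) :
    Primrec fun a => extend (m a) (s a) (p a) := by
  refine list_flatMap (optionToList.comp (list_head?.comp hp)) ?_
  refine ite (Primrec.eq.comp (primrec_configState.comp snd)
    (primrec_machineAccept (hm.comp fst))) (list_cons.comp (hp.comp fst) (const [])) ?_
  exact list_map (primrec_succs (hm.comp fst) (hs.comp fst) snd)
    (list_cons.comp snd (hp.comp (fst.comp fst)))

theorem primrec_acceptingRuns {m : α → Machine} {s : α → List Word} {x : α → Word} {t : α → ℕ}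
    (hm : Primrec m) (hs : Primrec s) (hx : Primrec x) (ht : Primrec t) :
    Primrec fun a => acceptingRuns (m a) (s a) (x a) (t a) := by
  have hruns : Primrec fun a => runs (m a) (s a) (x a) (t a) := by
    refine nat_iterate ht (list_cons.comp (list_cons.comp (primrec_init hm hx) (const []))
      (const [])) ?_
    exact list_flatMap snd (primrec_extend (hm.comp (fst.comp fst)) (hs.comp (fst.comp fst)) snd)
  have h1 : PrimrecRel fun (c : Config) (M : Machine) => c.state = M.accept :=
    Primrec.eq.comp (primrec_configState.comp fst) (primrec_machineAccept snd)
  have h2 : PrimrecRel fun (π : List Config) (M : Machine) =>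
      ∃ c ∈ π.head?.toList, c.state = M.accept :=
    h1.exists_mem_list.comp (optionToList.comp (list_head?.comp fst)) snd
  exact h2.listFilter.comp hruns hm

theorem primrecPred_acceptsIn {m : α → Machine} {s : α → List Word} {x : α → Word} {t : α → ℕ}
    (hm : Primrec m) (hs : Primrec s) (hx : Primrec x) (ht : Primrec t) :
    PrimrecPred fun a => AcceptsIn (m a) (s a) (x a) (t a) :=
  (Primrec.eq.comp (primrec_acceptingRuns hm hs hx ht) (const [])).not

theorem primrecPred_ambiguousIn {m : α → Machine} {s : α → List Word} {x : α → Word} {t : α → ℕ}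
    (hm : Primrec m) (hs : Primrec s) (hx : Primrec x) (ht : Primrec t) :
    PrimrecPred fun a => AmbiguousIn (m a) (s a) (x a) (t a) := by
  have hr := primrec_acceptingRuns hm hs hx ht
  have h1 : PrimrecRel fun (π₂ π₁ : List Config) => π₁ ≠ π₂ :=
    (Primrec.eq.comp snd fst).not
  have h2 : PrimrecRel fun (π₁ : List Config) (l : List (List Config)) =>
      ∃ π₂ ∈ l, π₁ ≠ π₂ := h1.exists_mem_list.comp snd fst
  exact h2.exists_mem_list.comp hr hr

end Primrec

/-! ### The oracle -/

/-- All words of length `n`. -/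
def words (n : ℕ) : List Word :=
  (fun L => L.flatMap fun w => [false :: w, true :: w])^[n] [[]]

theorem mem_words {n : ℕ} : ∀ {w : Word}, w ∈ words n ↔ w.length = n := by
  induction n with
  | zero => simp [words]
  | succ n ih =>
    intro w
    rw [words, Function.iterate_succ_apply', ← words]
    cases w with
    | nil => simp
    | cons b w => cases b <;> simp [ih]

/-- The sets of words that may be added to the oracle to treat the inputs of length `n`. -/
def candidates (n : ℕ) : List (List Word) :=
  (words n).flatMap fun y => (words n).flatMap fun z =>
    [[], [y ++ [false]], [z ++ [true]], [y ++ [false], z ++ [true]]]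

theorem mem_candidates {n : ℕ} {S : List Word} :
    S ∈ candidates n ↔ ∃ y z : Word, y.length = n ∧ z.length = n ∧
      (S = [] ∨ S = [y ++ [false]] ∨ S = [z ++ [true]] ∨ S = [y ++ [false], z ++ [true]]) := by
  simp only [candidates, List.mem_flatMap, mem_words, List.mem_cons, List.not_mem_nil, or_false]
  grind

theorem nil_mem_candidates (n : ℕ) : [] ∈ candidates n :=
  mem_candidates.2 ⟨List.replicate n false, List.replicate n false, by simp, by simp, .inl rfl⟩

theorem length_of_mem_candidate {n : ℕ} {S : List Word} (hS : S ∈ candidates n) {w : Word}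
    (hw : w ∈ S) : w.length = n + 1 := by
  obtain ⟨y, z, hy, hz, rfl | rfl | rfl | rfl⟩ := mem_candidates.1 hS <;>
    simp only [List.mem_cons, List.not_mem_nil, or_false] at hw
  · simp [hw, hy]
  · simp [hw, hz]
  · rcases hw with rfl | rfl <;> simp [hy, hz]

theorem eq_of_mem_candidate {n : ℕ} {S : List Word} (hS : S ∈ candidates n) {y z : Word}
    {b : Bool} (hy : y ++ [b] ∈ S) (hz : z ++ [b] ∈ S) : y = z := by
  obtain ⟨u, v, -, -, hS⟩ := mem_candidates.1 hS
  have key : ∀ {y : Word}, y ++ [b] ∈ S → y = if b then v else u := by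
    intro y hy
    have hy' : y ++ [b] = u ++ [false] ∨ y ++ [b] = v ++ [true] := by
      rcases hS with rfl | rfl | rfl | rfl <;>
        simp only [List.mem_cons, List.not_mem_nil, or_false] at hy <;> tauto
    rcases hy' with h | h <;> obtain ⟨rfl, hb⟩ := List.append_inj' h rfl <;>
      obtain rfl := List.singleton_inj.1 hb <;> rfl
  rw [key hy, key hz]

/-- With `S` added to the oracle `σ`, one of the machines in `R` is ambiguous on the input `0ⁿ`,
or the value of `R` there differs from the one prescribed by the size of `S`. -/
def Spoils (R : Combination) (σ : List Word) (n : ℕ) (S : List Word) : Prop :=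
  (∃ M ∈ R.machines, AmbiguousIn M (S ++ σ) (List.replicate n false) (2 ^ n)) ∨
  (S.length = 0 ∧ ¬ R.Holds fun M => AcceptsIn M (S ++ σ) (List.replicate n false) (2 ^ n)) ∨
  (S.length = 1 ∧ R.Holds fun M => AcceptsIn M (S ++ σ) (List.replicate n false) (2 ^ n))

open Classical in
/-- The first candidate that spoils `R`, and nothing if there is none. -/
noncomputable def spoiler (R : Combination) (σ : List Word) (n : ℕ) : List Word :=
  ((candidates n).filter fun S => Spoils R σ n S).headI

theorem spoiler_mem_candidates (R : Combination) (σ : List Word) (n : ℕ) :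
    spoiler R σ n ∈ candidates n := by
  classical
  unfold spoiler
  rcases h : (candidates n).filter fun S => Spoils R σ n S with _ | ⟨S, l⟩
  · exact nil_mem_candidates n
  · exact (List.mem_filter.1 (h ▸ List.mem_cons_self)).1

theorem spoils_spoiler {R : Combination} {σ : List Word} {n : ℕ}
    (h : ∃ S ∈ candidates n, Spoils R σ n S) : Spoils R σ n (spoiler R σ n) := by
  classical
  obtain ⟨S, hS, hS'⟩ := h
  have hmem : S ∈ (candidates n).filter fun S => Spoils R σ n S := by simp [hS, hS']
  unfold spoiler
  rcases h : (candidates n).filter fun S => Spoils R σ n S with _ | ⟨S', l⟩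
  · simp [h] at hmem
  · have : S' ∈ (candidates n).filter fun S => Spoils R σ n S := by
      rw [h]
      exact List.mem_cons_self
    simpa using (List.mem_filter.1 this).2

/-! ### Stages at tower-spaced lengths -/

/-- The lengths of the inputs that are treated. -/
def tower (s : ℕ) : ℕ := (fun n => 2 ^ n)^[s] 1

theorem tower_succ (s : ℕ) : tower (s + 1) = 2 ^ tower s := Function.iterate_succ_apply' _ _ _

theorem tower_strictMono : StrictMono tower :=
  strictMono_nat_of_lt_succ fun s => by
    rw [tower_succ]
    exact Nat.lt_two_pow_self

/-- The words added at stage `s` to the words `σ` added before. -/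
noncomputable def added (σ : List Word) (s : ℕ) : List Word :=
  -- The second component of `s` is padding: every combination recurs at infinitely many stages,
  -- hence at arbitrarily large lengths.
  ((Encodable.decode s.unpair.1 : Option Combination).map fun R => spoiler R σ (tower s)).getD []

/-- The words added to the oracle before stage `s`. -/
noncomputable def stage : ℕ → List Word
  | 0 => []
  | s + 1 => added (stage s) s ++ stage s

/-- The oracle. -/
def theOracle : Lang := {w | ∃ s, w ∈ stage s}

theorem added_mem_candidates (σ : List Word) (s : ℕ) : added σ s ∈ candidates (tower s) := by
  unfold added
  cases (Encodable.decode s.unpair.1 : Option Combination) with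
  | none => exact nil_mem_candidates _
  | some R => exact spoiler_mem_candidates R σ _

theorem stage_subset {s t : ℕ} (h : s ≤ t) : stage s ⊆ stage t := by
  induction h with
  | refl => exact List.Subset.refl _
  | step h ih => exact List.Subset.trans ih (List.subset_append_right _ _)

theorem exists_mem_added {s : ℕ} {w : Word} (h : w ∈ stage s) :
    ∃ k < s, w ∈ added (stage k) k := by
  induction s with
  | zero => simp [stage] at h
  | succ s ih =>
    rw [stage, List.mem_append] at h
    rcases h with h | h
    · exact ⟨s, Nat.lt_succ_self s, h⟩
    · obtain ⟨k, hk, h⟩ := ih h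
      exact ⟨k, hk.trans (Nat.lt_succ_self s), h⟩

theorem mem_theOracle_iff {w : Word} : w ∈ theOracle ↔ ∃ k, w ∈ added (stage k) k := by
  constructor
  · rintro ⟨s, h⟩
    obtain ⟨k, -, h⟩ := exists_mem_added h
    exact ⟨k, h⟩
  · rintro ⟨k, h⟩
    exact ⟨k + 1, List.mem_append_left _ h⟩

/-- Stage k adds only words of length `tower k + 1`, and `tower` is injective. -/
theorem mem_theOracle_iff_of_length_eq {s : ℕ} {w : Word} (hw : w.length = tower s + 1) :
    w ∈ theOracle ↔ w ∈ added (stage s) s := by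
  rw [mem_theOracle_iff]
  refine ⟨fun ⟨k, h⟩ => ?_, fun h => ⟨s, h⟩⟩
  have := length_of_mem_candidate (added_mem_candidates _ _) h
  obtain rfl : k = s := tower_strictMono.injective (by omega)
  exact h

/-- From stage s on, only words longer than `tower s` are added. -/
theorem mem_theOracle_iff_of_length_le {s : ℕ} {w : Word} (hw : w.length ≤ tower s) :
    w ∈ theOracle ↔ w ∈ stage s := by
  refine ⟨fun h => ?_, fun h => ⟨s, h⟩⟩
  obtain ⟨k, h⟩ := mem_theOracle_iff.1 h
  have := length_of_mem_candidate (added_mem_candidates _ _) h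
  have hks : k < s := tower_strictMono.lt_iff_lt.1 (by omega)
  exact stage_subset hks (List.mem_append_left _ h)

theorem tagLang_theOracle_mem_UP (b : Bool) : tagLang theOracle b ∈ UP theOracle := by
  refine tagLang_mem_UP fun y z hyz hy hz => ?_
  obtain ⟨k, hk⟩ := mem_theOracle_iff.1 hy
  have h := length_of_mem_candidate (added_mem_candidates _ _) hk
  refine eq_of_mem_candidate (added_mem_candidates _ _) hk
    ((mem_theOracle_iff_of_length_eq ?_).1 hz)
  simpa [hyz] using h

theorem mem_tagLang_theOracle {s : ℕ} {x : Word} (hx : x.length = tower s) {b : Bool} :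
    x ∈ tagLang theOracle b ↔ ∃ y, y ++ [b] ∈ added (stage s) s := by
  constructor
  · rintro ⟨y, hy, h⟩
    exact ⟨y, (mem_theOracle_iff_of_length_eq (by simp [hy, hx])).1 h⟩
  · rintro ⟨y, h⟩
    have := length_of_mem_candidate (added_mem_candidates _ _) h
    refine ⟨y, ?_, (mem_theOracle_iff_of_length_eq this).2 h⟩
    rw [List.length_append, List.length_singleton] at this
    omega

/-! ### The oracle is recursive -/

section Primrec

open Primrec

variable {α : Type*} [Primcodable α]

theorem primrec_words : Primrec words := by
  have h : Primrec₂ fun (_ : ℕ × List Word) (w : Word) => [false :: w, true :: w] :=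
    list_cons.comp (list_cons.comp (const false) snd)
      (list_cons.comp (list_cons.comp (const true) snd) (const []))
  exact nat_iterate .id (const [[]]) (list_flatMap snd h)

theorem primrec_candidates : Primrec candidates := by
  have hy : Primrec fun p : (ℕ × Word) × Word => p.1.2 ++ [false] :=
    list_append.comp (snd.comp fst) (const [false])
  have hz : Primrec fun p : (ℕ × Word) × Word => p.2 ++ [true] :=
    list_append.comp snd (const [true])
  refine list_flatMap primrec_words (list_flatMap (primrec_words.comp fst) ?_)
  have hz' := list_cons.comp hz (const [])
  exact list_cons.comp (const []) (list_cons.comp (list_cons.comp hy (const []))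
    (list_cons.comp hz' (list_cons.comp (list_cons.comp hy hz') (const []))))

theorem primrec_two_pow {f : α → ℕ} (hf : Primrec f) : Primrec fun a => 2 ^ f a :=
  (Primrec₂.unpaired'.1 Nat.Primrec.pow).comp (const 2) hf

theorem primrec_replicate {f : α → ℕ} (hf : Primrec f) :
    Primrec fun a => List.replicate (f a) false :=
  (list_map (list_range.comp hf) (Primrec₂.const false)).of_eq fun a => by simp

theorem primrec_tower : Primrec tower :=
  nat_iterate .id (const 1) (primrec_two_pow snd)

theorem primrec_machines : Primrec Combination.machines :=
  list_flatMap .id (list_cons.comp (snd.comp snd) (fst.comp snd))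

/-- Parameters of the simulation: an oracle and the length of the input. -/
abbrev Params := List Word × ℕ

theorem primrecRel_acceptsIn : PrimrecRel fun (M : Machine) (q : Params) =>
    AcceptsIn M q.1 (List.replicate q.2 false) (2 ^ q.2) :=
  primrecPred_acceptsIn fst (fst.comp snd) (primrec_replicate (snd.comp snd))
    (primrec_two_pow (snd.comp snd))

theorem primrecRel_ambiguousIn : PrimrecRel fun (M : Machine) (q : Params) =>
    AmbiguousIn M q.1 (List.replicate q.2 false) (2 ^ q.2) :=
  primrecPred_ambiguousIn fst (fst.comp snd) (primrec_replicate (snd.comp snd))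
    (primrec_two_pow (snd.comp snd))

theorem primrecRel_holds : PrimrecRel fun (R : Combination) (q : Params) =>
    R.Holds fun M => AcceptsIn M q.1 (List.replicate q.2 false) (2 ^ q.2) := by
  have h : PrimrecRel fun (r : List Machine × Machine) (q : Params) =>
      (∀ M ∈ r.1, AcceptsIn M q.1 (List.replicate q.2 false) (2 ^ q.2)) ∧
        ¬ AcceptsIn r.2 q.1 (List.replicate q.2 false) (2 ^ q.2) :=
    (primrecRel_acceptsIn.forall_mem_list.comp (fst.comp fst) snd).and
      (primrecRel_acceptsIn.comp (snd.comp fst) snd).not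
  exact h.exists_mem_list

theorem primrecRel_spoils : PrimrecRel fun (S : List Word) (q : Combination × Params) =>
    Spoils q.1 q.2.1 q.2.2 S := by
  have hq : Primrec fun p : List Word × Combination × Params => (p.1 ++ p.2.2.1, p.2.2.2) :=
    (list_append.comp fst (fst.comp (snd.comp snd))).pair (snd.comp (snd.comp snd))
  have hR : Primrec fun p : List Word × Combination × Params => p.2.1 := fst.comp snd
  have hl : Primrec fun p : List Word × Combination × Params => p.1.length :=
    list_length.comp fst
  have hh := primrecRel_holds.comp hR hq
  exact (primrecRel_ambiguousIn.exists_mem_list.comp (primrec_machines.comp hR) hq).or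
    (((Primrec.eq.comp hl (const 0)).and hh.not).or ((Primrec.eq.comp hl (const 1)).and hh))

theorem primrec_spoiler {r : α → Combination} {s : α → List Word} {n : α → ℕ}
    (hr : Primrec r) (hs : Primrec s) (hn : Primrec n) :
    Primrec fun a => spoiler (r a) (s a) (n a) := by
  classical
  exact list_headI.comp (primrecRel_spoils.listFilter.comp (primrec_candidates.comp hn)
    (hr.pair (hs.pair hn)))

theorem primrec_added {s : α → List Word} {n : α → ℕ} (hs : Primrec s) (hn : Primrec n) :
    Primrec fun a => added (s a) (n a) := by
  have h : Primrec₂ fun (a : α) (R : Combination) => spoiler R (s a) (tower (n a)) :=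
    primrec_spoiler snd (hs.comp fst) (primrec_tower.comp (hn.comp fst))
  exact option_getD.comp
    (option_map (Primrec.decode.comp (fst.comp (Primrec.unpair.comp hn))) h) (const [])

theorem primrec_stage : Primrec stage := by
  have h : Primrec₂ fun (s : ℕ) (σ : List Word) => added σ s ++ σ :=
    list_append.comp (primrec_added snd fst) snd
  refine (nat_rec₁ [] h).of_eq fun s => ?_
  induction s with
  | zero => rfl
  | succ s ih => simp only [stage, ih]

/-- Since |w| ≤ `tower` |w|, membership of w is settled by the finite list `stage` |w|. -/
theorem computablePred_theOracle : ComputablePred fun w : Word => w ∈ theOracle := by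
  have h : PrimrecPred fun w : Word => w ∈ stage w.length :=
    primrecRel_mem.comp (primrec_stage.comp list_length) .id
  exact h.computablePred.of_eq fun w =>
    (mem_theOracle_iff_of_length_le (tower_strictMono.le_apply)).symm

end Primrec

/-! ### The requirements are met -/

/-- The factor K is quantified inside the induction because a sum of polynomials needs the bound
with 2K for each summand. -/
theorem eventually_mul_eval_lt_two_pow (p : Polynomial ℕ) :
    ∀ K : ℕ, ∀ᶠ n in Filter.atTop, K * p.eval n < 2 ^ n := by
  induction p using Polynomial.induction_on' with
  | add p q hp hq =>
    intro K
    filter_upwards [hp (2 * K), hq (2 * K)] with n h1 h2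
    rw [Polynomial.eval_add]
    linarith
  | monomial k a =>
    intro K
    have h := tendsto_pow_const_div_const_pow_of_one_lt k (one_lt_two (α := ℝ))
    have hpos : (0 : ℝ) < 1 / (K * a + 1) := by positivity
    filter_upwards [h.eventually_lt_const hpos] with n hn
    rw [Polynomial.eval_monomial]
    rw [div_lt_div_iff₀ (by positivity) (by positivity)] at hn
    have h1 : (n : ℝ) ^ k * (K * a + 1) < 2 ^ n := by linarith
    have h2 : n ^ k * (K * a + 1) < 2 ^ n := by exact_mod_cast h1
    nlinarith [Nat.zero_le (n ^ k)]

theorem oracleOf_cons (w : Word) (σ : List Word) :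
    oracleOf (w :: σ) = insert w (oracleOf σ) := by
  ext v
  simp [oracleOf]

theorem exists_spoils {R : Combination} {n w : ℕ} {σ : List Word}
    (hw : ∀ M ∈ R.machines, ∀ (A : Lang) (π : List Config),
      M.IsPath A (List.replicate n false) π → π.length ≤ w)
    (hn : 4 * (R.machines.length * w) < 2 ^ n) (hwn : w ≤ 2 ^ n) :
    ∃ S ∈ candidates n, Spoils R σ n S := by
  by_contra! hno
  set x : Word := List.replicate n false
  have hlen : ∀ M ∈ R.machines, ∀ (A : Lang) (π : List Config), M.IsPath A x π →
      π.length ≤ 2 ^ n := fun M hM A π h => (hw M hM A π h).trans hwn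
  have hholds : ∀ τ : List Word, (R.Holds fun M => AcceptsIn M τ x (2 ^ n)) ↔
      R.Holds fun M => x ∈ M.language (oracleOf τ) := fun τ =>
    Combination.Holds.congr fun M hM => acceptsIn_iff (hlen M hM _)
  -- Unambiguity holds for all y and z because no two-word candidate spoils R.
  obtain ⟨y, z, hy, hz, hyz⟩ := exists_robust_pair (B := oracleOf σ) hw hn (by
    intro M hM y z hy hz π₁ π₂ h₁ h₂
    by_contra hne
    refine hno _ (mem_candidates.2 ⟨y, z, hy, hz, .inr (.inr (.inr rfl))⟩) (.inl ⟨M, hM, ?_⟩)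
    rw [ambiguousIn_iff (hlen M hM _)]
    simp only [List.cons_append, List.nil_append, oracleOf_cons]
    exact ⟨π₁, π₂, h₁, h₂, hne⟩)
  have h0 : R.Holds fun M => x ∈ M.language (oracleOf σ) := by
    by_contra h
    exact hno [] (nil_mem_candidates n) (.inr (.inl ⟨rfl, fun h' => h ((hholds _).1 h')⟩))
  have h1 : ¬ R.Holds fun M => x ∈ M.language (insert (y ++ [false]) (oracleOf σ)) := by
    intro h
    rw [← oracleOf_cons] at h
    exact hno [y ++ [false]] (mem_candidates.2 ⟨y, z, hy, hz, .inr (.inl rfl)⟩)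
      (.inr (.inr ⟨rfl, (hholds _).2 h⟩))
  have h2 : ¬ R.Holds fun M => x ∈ M.language (insert (z ++ [true]) (oracleOf σ)) := by
    intro h
    rw [← oracleOf_cons] at h
    exact hno [z ++ [true]] (mem_candidates.2 ⟨y, z, hy, hz, .inr (.inr (.inl rfl))⟩)
      (.inr (.inr ⟨rfl, (hholds _).2 h⟩))
  obtain ⟨r, hr, hacc, hrej⟩ := h0
  have hmem : ∀ M ∈ r.1, M ∈ R.machines := fun M hM =>
    Combination.mem_machines.2 ⟨r, hr, .inr hM⟩
  -- The subtracted machine must accept after either single insertion, since otherwise the same term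
  -- r would make R hold there; robustness then makes it accept with nothing added.
  refine hrej ((hyz r.2 (Combination.mem_machines.2 ⟨r, hr, .inl rfl⟩)).2 ?_ ?_)
  · by_contra h
    exact h1 ⟨r, hr, fun M hM => ((hyz M (hmem M hM)).1 (hacc M hM)).1, h⟩
  · by_contra h
    exact h2 ⟨r, hr, fun M hM => ((hyz M (hmem M hM)).1 (hacc M hM)).2, h⟩

theorem Machine.IsAcceptingPath.congr_of_length_le {M : Machine} {A B : Lang} {x : Word} {t : ℕ}
    {π : List Config} (h : M.IsAcceptingPath A x π) (ht : π.length ≤ t)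
    (hAB : ∀ q : Word, q.length ≤ t → (q ∈ A ↔ q ∈ B)) : M.IsAcceptingPath B x π :=
  h.congr fun _ hc => hAB _ ((h.1.asked_length_lt hc).le.trans ht)

/-- Every combination of `UP` machines relative to the oracle is wrong on the input of some
stage. -/
theorem exists_stage_spoiled {R : Combination} (hR : R.IsUP theOracle) :
    ∃ s, ((added (stage s) s).length = 0 ∧
        List.replicate (tower s) false ∉ R.language theOracle) ∨
      ((added (stage s) s).length = 1 ∧
        List.replicate (tower s) false ∈ R.language theOracle) := by
  classical
  set r := R.machines.length
  have hev : ∀ᶠ n in Filter.atTop, ∀ M ∈ R.machines.toFinset, ∃ p : Polynomial ℕ,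
      (∀ (A : Lang) (x : Word) (π : List Config), M.IsPath A x π → π.length ≤ p.eval x.length) ∧
        (4 * r + 1) * p.eval n < 2 ^ n := by
    rw [Filter.eventually_all_finset]
    intro M hM
    obtain ⟨p, hp⟩ := (hR M (List.mem_toFinset.1 hM)).1
    filter_upwards [eventually_mul_eval_lt_two_pow p (4 * r + 1)] with n hn
    exact ⟨p, hp, hn⟩
  obtain ⟨N, hN⟩ := Filter.eventually_atTop.1 hev
  -- A stage that treats R, with N as padding so that its length is at least N.
  set s := Nat.pair (Encodable.encode R) N
  set n := tower s
  set x : Word := List.replicate n false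
  -- A common path bound, with 4rw < 2ⁿ for the counting and w ≤ 2ⁿ for the clock.
  set w := 2 ^ n / (4 * r + 1)
  have hNn : N ≤ n := (Nat.right_le_pair _ _).trans tower_strictMono.le_apply
  have hlen : ∀ M ∈ R.machines, ∀ (A : Lang) (π : List Config), M.IsPath A x π →
      π.length ≤ w := by
    intro M hM A π h
    obtain ⟨p, hp, hpn⟩ := hN n hNn M (List.mem_toFinset.2 hM)
    refine (hp A x π h).trans ?_
    rw [Nat.le_div_iff_mul_le (Nat.succ_pos _), List.length_replicate, Nat.mul_comm]
    exact hpn.le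
  have hw1 : (4 * r + 1) * w ≤ 2 ^ n := Nat.mul_div_le _ _
  have hw2 : 4 * (r * w) < 2 ^ n := by
    have h0 : 0 < 2 ^ n := by positivity
    rcases Nat.eq_zero_or_pos w with h | h
    · simp [h]
    · linarith
  have hwn : w ≤ 2 ^ n := Nat.div_le_self _ _
  have hsp : Spoils R (stage s) n (added (stage s) s) := by
    have hadd : added (stage s) s = spoiler R (stage s) n := by
      simp [added, s, n, Nat.unpair_pair]
    rw [hadd]
    exact spoils_spoiler (exists_spoils hlen hw2 hwn)
  -- Words added after stage s are longer than `tower (s + 1)` = 2ⁿ, so the simulated oracle is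
  -- right on all possible queries.
  have hagree : ∀ q : Word, q.length ≤ 2 ^ n →
      (q ∈ theOracle ↔ q ∈ oracleOf (added (stage s) s ++ stage s)) := by
    intro q hq
    rw [← tower_succ] at hq
    exact mem_theOracle_iff_of_length_le hq
  have hlen' : ∀ M ∈ R.machines, ∀ (A : Lang) (π : List Config), M.IsPath A x π →
      π.length ≤ 2 ^ n := fun M hM A π h => (hlen M hM A π h).trans hwn
  have hholds : (R.Holds fun M => AcceptsIn M (added (stage s) s ++ stage s) x (2 ^ n)) ↔
      x ∈ R.language theOracle := by
    refine Combination.Holds.congr fun M hM => ?_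
    rw [acceptsIn_iff (hlen' M hM _)]
    exact ⟨fun ⟨π, h⟩ => ⟨π, h.congr_of_length_le (hlen' M hM _ _ h.1)
        fun q hq => (hagree q hq).symm⟩,
      fun ⟨π, h⟩ => ⟨π, h.congr_of_length_le (hlen' M hM _ _ h.1) hagree⟩⟩
  refine ⟨s, ?_⟩
  rcases hsp with ⟨M, hM, h⟩ | ⟨h1, h2⟩ | ⟨h1, h2⟩
  -- Ambiguity found in the simulation would persist relative to the final oracle, against `hR`.
  · obtain ⟨π₁, π₂, h₁, h₂, hne⟩ := (ambiguousIn_iff (hlen' M hM _)).1 h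
    exact absurd ((hR M hM).2 x π₁ π₂
      (h₁.congr_of_length_le (hlen' M hM _ _ h₁.1) fun q hq => (hagree q hq).symm)
      (h₂.congr_of_length_le (hlen' M hM _ _ h₂.1) fun q hq => (hagree q hq).symm)) hne
  · exact .inl ⟨h1, fun h => h2 (hholds.2 h)⟩
  · exact .inr ⟨h1, hholds.1 h2⟩

theorem mem_tagLang_of_length_eq_zero {s : ℕ} (h : (added (stage s) s).length = 0) (b : Bool) :
    List.replicate (tower s) false ∉ tagLang theOracle b := by
  rw [mem_tagLang_theOracle List.length_replicate, List.length_eq_zero_iff.1 h]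
  simp

theorem mem_tagLang_of_length_eq_one {s : ℕ} (h : (added (stage s) s).length = 1) :
    ∃ b, List.replicate (tower s) false ∈ tagLang theOracle b ∧
      List.replicate (tower s) false ∉ tagLang theOracle (!b) := by
  simp only [mem_tagLang_theOracle (List.length_replicate)]
  obtain ⟨y, z, -, -, hS | hS | hS | hS⟩ :=
    mem_candidates.1 (added_mem_candidates (stage s) s) <;> rw [hS] at h ⊢
  · simp at h
  · refine ⟨false, ⟨y, by simp⟩, fun ⟨u, hu⟩ => ?_⟩
    simpa using (List.append_inj' (List.mem_singleton.1 hu) rfl).2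
  · refine ⟨true, ⟨z, by simp⟩, fun ⟨u, hu⟩ => ?_⟩
    simpa using (List.append_inj' (List.mem_singleton.1 hu) rfl).2
  · simp at h

/-- A language that contains the words that are in neither of the two tag languages, but none that
are in exactly one of them, is not a combination of `UP` languages. -/
theorem combination_language_ne {R : Combination} (hR : R.IsUP theOracle) {L : Lang}
    (h₀ : ∀ x, (∀ b, x ∉ tagLang theOracle b) → x ∈ L)
    (h₁ : ∀ x b, x ∈ tagLang theOracle b → x ∉ tagLang theOracle (!b) → x ∉ L) :
    R.language theOracle ≠ L := by
  rintro rfl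
  obtain ⟨s, ⟨h, hx⟩ | ⟨h, hx⟩⟩ := exists_stage_spoiled hR
  · exact hx (h₀ _ (mem_tagLang_of_length_eq_zero h))
  · obtain ⟨b, hb, hb'⟩ := mem_tagLang_of_length_eq_one h
    exact h₁ _ b hb hb' hx

/-! ### The two separating languages -/

/-- The words in neither of the two tag languages. -/
def neitherLang (A : Lang) : Lang := ((Set.univ \ tagLang A false) ∪ ∅) \ tagLang A true

/-- The third level of C requires a union, for which ∅ is used; the even levels remove the two tag
languages. -/
theorem neitherLang_mem_C : neitherLang theOracle ∈ C (UP theOracle) 4 := by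
  have h2 : Set.univ \ tagLang theOracle false ∈ C (UP theOracle) 2 := by
    simp only [C]
    rw [if_neg (by decide)]
    refine ⟨_, univ_mem_UP _, (tagLang theOracle false)ᶜ, ?_, rfl⟩
    simpa [co] using tagLang_theOracle_mem_UP false
  have h3 : (Set.univ \ tagLang theOracle false) ∪ ∅ ∈ C (UP theOracle) 3 := by
    rw [C, if_pos (by decide)]
    exact ⟨_, h2, ∅, empty_mem_UP _, rfl⟩
  rw [C, if_neg (by decide)]
  refine ⟨_, h3, (tagLang theOracle true)ᶜ, ?_, rfl⟩
  simpa [co] using tagLang_theOracle_mem_UP true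

theorem neitherLang_mem_BC : neitherLang theOracle ∈ BC (UP theOracle) := by
  have h : ∀ b, tagLang theOracle b ∈ BooleanSubalgebra.closure (UP theOracle) := fun b =>
    BooleanSubalgebra.subset_closure (tagLang_theOracle_mem_UP b)
  have h' : Set.univ ∈ BooleanSubalgebra.closure (UP theOracle) :=
    BooleanSubalgebra.subset_closure (univ_mem_UP _)
  have h'' : ∅ ∈ BooleanSubalgebra.closure (UP theOracle) :=
    BooleanSubalgebra.subset_closure (empty_mem_UP _)
  exact BooleanSubalgebra.sdiff_mem
    (BooleanSubalgebra.sup_mem (BooleanSubalgebra.sdiff_mem h' (h false)) h'') (h true)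

theorem combination_language_ne_neitherLang {R : Combination} (hR : R.IsUP theOracle) :
    R.language theOracle ≠ neitherLang theOracle := by
  refine combination_language_ne hR (fun x hx => ?_) fun x b hb _ hx => ?_
  · simp [neitherLang, hx false, hx true]
  · cases b <;> simp_all [neitherLang]

/-- The words in an even number of the two tag languages. -/
def evenLang (A : Lang) : Lang :=
  symmDiff (symmDiff Set.univ (tagLang A false)) (tagLang A true)

theorem evenLang_mem_SD : evenLang theOracle ∈ SD (UP theOracle) 3 :=
  ⟨_, ⟨_, univ_mem_UP _, _, tagLang_theOracle_mem_UP false, rfl⟩, _,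
    tagLang_theOracle_mem_UP true, rfl⟩

theorem combination_language_ne_evenLang {R : Combination} (hR : R.IsUP theOracle) :
    R.language theOracle ≠ evenLang theOracle := by
  refine combination_language_ne hR (fun x hx => ?_) fun x b hb hb' hx => ?_
  · simp [evenLang, Set.mem_symmDiff, hx false, hx true]
  · cases b <;> simp_all [evenLang, Set.mem_symmDiff]

theorem notMem_EH {L : Lang}
    (hL : ∀ R : Combination, R.IsUP theOracle → R.language theOracle ≠ L) :
    L ∉ EH (UP theOracle) := by
  rintro ⟨k, -, h⟩
  obtain ⟨R, hR, h⟩ := exists_combination_E h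
  exact hL R hR h

theorem notMem_DH {L : Lang}
    (hL : ∀ R : Combination, R.IsUP theOracle → R.language theOracle ≠ L) :
    L ∉ DH (UP theOracle) := by
  rintro ⟨k, -, h⟩
  obtain ⟨R, hR, h⟩ := exists_combination_D h
  exact hL R hR h

end UPOracle

theorem theorem3p9 :
    ∃ A : UPOracle.Lang,
      ComputablePred (fun w : UPOracle.Word => w ∈ A) ∧
      ¬ UPOracle.C (UPOracle.UP A) 4 ⊆ UPOracle.EH (UPOracle.UP A) ∧
      ¬ UPOracle.SD (UPOracle.UP A) 3 ⊆ UPOracle.EH (UPOracle.UP A) ∧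
      UPOracle.EH (UPOracle.UP A) ≠ UPOracle.BC (UPOracle.UP A) ∧
      UPOracle.DH (UPOracle.UP A) ≠ UPOracle.BC (UPOracle.UP A) := by
  have hE := UPOracle.notMem_EH fun _ => UPOracle.combination_language_ne_neitherLang
  have hD := UPOracle.notMem_DH fun _ => UPOracle.combination_language_ne_neitherLang
  have hE' := UPOracle.notMem_EH fun _ => UPOracle.combination_language_ne_evenLang
  exact ⟨UPOracle.theOracle, UPOracle.computablePred_theOracle,
    fun h => hE (h UPOracle.neitherLang_mem_C), fun h => hE' (h UPOracle.evenLang_mem_SD),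
    fun h => hE (h ▸ UPOracle.neitherLang_mem_BC), fun h => hD (h ▸ UPOracle.neitherLang_mem_BC)⟩
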